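/- Let $m_1>0$, let $r$ be the Euclidean radius, $M=\mathbb R^3\setminus B(0,\frac{m_1}{2})$ (so $\partial M=\partial B(0,\frac{m_1}{2})$), and let $(\rho,z,\varphi)$ be cylindrical coordinates on $\mathbb R^3$. Consider metrics on $M$ of the form $$g=e^{-2U_S+2\alpha_S}(d\rho^2+dz^2)+\rho^2e^{-2U_S}\big(d\varphi+\rho\,\bar B_S\,d\rho+\bar A_S\,dz\big)^2 .$$ Call the data $(U_S,\alpha_S,\bar B_S,\bar A_S)$ admissible if: - the four functions are smooth up to the boundary and $\varphi$-independent, and $\alpha_S=0$ on the axis $\{\rho=0\}$; - for some integer $\ell\ge 5$, as $r\to\infty$, $g_{ij}-\delta_{ij}=o_\ell(r^{-1/2})$ in Cartesian coordinates, $U_S=o_{\ell-3}(r^{-1/2})$, $\alpha_S=o_{\ell-4}(r^{-1/2})$, $\bar B_S=o_{\ell-3}(r^{-5/2})$ and $\bar A_S=o_{\ell-3}(r^{-3/2})$, where $f=o_\ell(r^\mu)$ means that all partial derivatives of $f$ of order $j\le\ell$ are $o(r^{\mu-j})$; moreover $\partial_l g_{ij}\in L^2$ near infinity; - the scalar curvature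 $R_g$ is non-negative on $M$; - $\partial M$ is an outermost minimal surface: it is minimal for $g$, and $M$ contains no non-empty compact (immersed, boundaryless) minimal surface other than $\partial M$. For functions $\Phi,\Psi$ on $M$ put $$\begin{aligned}J_{\Phi,\Psi}(U_S,\alpha_S)=&\ \frac1{4\pi}\int_{M}\Big\{\frac12\Phi\,\Big|\nabla U_S+\frac1\Phi\nabla(\Phi-\Psi)\Big|^2-\frac1{2\Phi}|\nabla(\Phi-\Psi)|^2\Big\}\,d^3x\\&+\frac1{4\pi}\int_{\partial M}\Big\{\frac2{m_1}\Phi+\frac12\alpha_S\Big(\partial_r\Phi+\frac2{m_1}\Phi\Big)-U_S\,\partial_r\Psi\Big\}\,d\sigma-\sqrt{\frac1{16\pi}\int_{\partial M}e^{\alpha_S-2U_S}\,d\sigma}\,,\end{aligned}$$ where gradients, norms and measures are Euclidean, and let $\Phi_*=1-\frac{m_1^2}{4r^2}$, $\Psi_*=-\frac{m_1}{r}$. Proposition. For every $m_1>0$ there is $k_0>0$ such that for every $0<k<k_0$ the conformally flat data $\alpha_S\equiv\bar B_S\equiv\bar A_S\equiv0$, $$U_S=-2\log\Big[1+\frac{6k+m_1^2}{2m_1r}-\frac{k}{2r^2}\Big],$$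 are admissible (in particular $\partial M$ is an outermost minimal surface), the scalar curvature $R_g$ is strictly positive on $M$, and 1. $U_S-\frac12\alpha_S\equiv C_H$ on $\partial M$ for a constant $C_H<-2\log2$; 2. the volume integral in $J_{\Phi_*,\Psi_*}(U_S,\alpha_S)$ converges absolutely and $J_{\Phi_*,\Psi_*}(U_S,\alpha_S)<0$. Hence $J_{\Phi_*,\Psi_*}\ge0$ fails for some admissible data, so the Penrose inequality cannot be obtained from non-negativity of $J_{\Phi_*,\Psi_*}$ on admissible data. -/

import Mathlib

open scoped ContDiff

noncomputable section

namespace AxiPenrose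

/-- Euclidean three-space with Cartesian coordinates `x 0 = x_S`, `x 1 = y_S`, `x 2 = z_S`. -/
abbrev E3 : Type := EuclideanSpace ℝ (Fin 3)

/-- A (pointwise) symmetric bilinear form on `ℝ³`, written in Cartesian components. -/
abbrev Mat3 : Type := Matrix (Fin 3) (Fin 3) ℝ

/-- The partial derivative `∂_i f`. -/
def pd (i : Fin 3) (f : E3 → ℝ) (x : E3) : ℝ := fderiv ℝ f x (EuclideanSpace.single i 1)

/-- The flat radial derivative `∂_r f`. -/
def radialDeriv (f : E3 → ℝ) (x : E3) : ℝ := fderiv ℝ f x (‖x‖⁻¹ • x)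

/-! ### Riemannian geometry in Cartesian coordinates -/

/-- Christoffel symbols `Γ^k_{ij}` of the metric `g`. -/
def christoffel (g : E3 → Mat3) (k i j : Fin 3) (x : E3) : ℝ :=
  (1 / 2) * ∑ l, (g x)⁻¹ k l *
    (pd i (fun y => g y j l) x + pd j (fun y => g y i l) x - pd l (fun y => g y i j) x)

/-- Ricci tensor of `g`. -/
def ricci (g : E3 → Mat3) (i j : Fin 3) (x : E3) : ℝ :=
  ∑ k, (pd k (christoffel g k i j) x - pd j (christoffel g k i k) x)
    + ∑ k, ∑ l, (christoffel g k k l x * christoffel g l i j x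
        - christoffel g k j l x * christoffel g l i k x)

/-- Scalar curvature of `g`. -/
def scalarCurvature (g : E3 → Mat3) (x : E3) : ℝ :=
  ∑ i, ∑ j, (g x)⁻¹ i j * ricci g i j x

/-- Components `(∇_g F)^i = g^{ij} ∂_j F` of the Riemannian gradient. -/
def metricGrad (g : E3 → Mat3) (F : E3 → ℝ) (i : Fin 3) (x : E3) : ℝ :=
  ∑ j, (g x)⁻¹ i j * pd j F x

/-- The length `|∇_g F|_g`. -/
def metricGradNorm (g : E3 → Mat3) (F : E3 → ℝ) (x : E3) : ℝ :=
  Real.sqrt (∑ i, metricGrad g F i x * pd i F x)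

/-- The mean curvature `div_g (∇_g F / |∇_g F|_g)` at `x` of the level set of `F` through `x`,
with respect to the unit normal `∇_g F / |∇_g F|_g`. -/
def levelMeanCurvature (g : E3 → Mat3) (F : E3 → ℝ) (x : E3) : ℝ :=
  (Real.sqrt (g x).det)⁻¹ *
    ∑ i, pd i (fun y => Real.sqrt (g y).det * (metricGrad g F i y / metricGradNorm g F y)) x

/-- `f : N → ℝ³` is an immersed surface without boundary with vanishing `g`-mean curvature:
every point of `N` has an open neighbourhood `W` which `f` embeds onto the zero set of a `C²`
function `F` without critical points on an open set `V`, and the mean curvature of this zero set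
vanishes. -/
def IsMinimalSurface (g : E3 → Mat3) {N : Type} [TopologicalSpace N] (f : N → E3) : Prop :=
  ∀ p : N, ∃ (W : Set N) (V : Set E3) (F : E3 → ℝ),
    IsOpen W ∧ p ∈ W ∧ IsOpen V ∧ ContDiffOn ℝ 2 F V ∧ (∀ x ∈ V, fderiv ℝ F x ≠ 0) ∧
    Topology.IsEmbedding (W.domRestrict f) ∧ f '' W = {x | x ∈ V ∧ F x = 0} ∧
    ∀ x ∈ f '' W, levelMeanCurvature g F x = 0

/-- The manifold `M = ℝ³ \ B(0, m₁/2)`, with its boundary. -/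
def exterior (m₁ : ℝ) : Set E3 := {x | m₁ / 2 ≤ ‖x‖}

/-- The boundary `∂M = ∂B(0, m₁/2)`. -/
def horizon (m₁ : ℝ) : Set E3 := Metric.sphere (0 : E3) (m₁ / 2)

/-- `∂M` is an outermost minimal surface of `(M, g)`: it is minimal and `M` contains no
(non-empty) compact immersed minimal surface other than `∂M`. -/
def HasOutermostMinimalBoundary (m₁ : ℝ) (g : E3 → Mat3) : Prop :=
  IsMinimalSurface g (Subtype.val : horizon m₁ → E3) ∧
  ∀ (N : Type) [TopologicalSpace N] [CompactSpace N] [T2Space N] [Nonempty N] (f : N → E3),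
    IsMinimalSurface g f → Set.range f ⊆ exterior m₁ → Set.range f = horizon m₁

/-- `f = o_k(r^μ)`: all derivatives of order `l ≤ k` are `o(r^(μ - l))` as `r → ∞`. -/
def IsLittleOk (k : ℕ) (μ : ℝ) (f : E3 → ℝ) : Prop :=
  ∀ l : ℕ, l ≤ k →
    (fun x => iteratedFDeriv ℝ l f x) =o[Bornology.cobounded E3] fun x => ‖x‖ ^ (μ - (l : ℝ))

/-! ### Axisymmetric data -/

/-- The metric functions `U_S`, `α_S`, `B̄_S`, `Ā_S`. -/
structure AxiData where
  U : E3 → ℝ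
  α : E3 → ℝ
  B : E3 → ℝ
  A : E3 → ℝ

/-- The Cartesian components of
`g = e^{-2U+2α} (dρ² + dz²) + ρ² e^{-2U} (dφ + ρ B dρ + A dz)²`.
Here `ρ dρ = x dx + y dy`, `ρ² dφ = x dy - y dx`, and `dρ² + ρ² dφ² = dx² + dy²` is used to write
the metric as
`e^{-2U} [dx² + dy² + ρ⁻² (e^{2α} - 1) (ρ dρ)² + e^{2α} dz² + 2 (ρ² dφ) θ + ρ² θ²]`
with `θ = B ρ dρ + A dz`, a form which is also correct on the axis (where `α = 0`). -/
def AxiData.metric (D : AxiData) (x : E3) : Mat3 :=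
  let ρρ : ℝ := x 0 ^ 2 + x 1 ^ 2
  let dxy : Fin 3 → ℝ := ![1, 1, 0]
  let dz : Fin 3 → ℝ := ![0, 0, 1]
  let ρdρ : Fin 3 → ℝ := ![x 0, x 1, 0]
  let ρρdφ : Fin 3 → ℝ := ![-x 1, x 0, 0]
  let θ : Fin 3 → ℝ := fun i => D.B x * ρdρ i + D.A x * dz i
  Matrix.of fun i j => Real.exp (-2 * D.U x) *
    ((if i = j then dxy i else 0)
      + (Real.exp (2 * D.α x) - 1) / ρρ * (ρdρ i * ρdρ j)
      + Real.exp (2 * D.α x) * (dz i * dz j)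
      + (ρρdφ i * θ j + θ i * ρρdφ j)
      + ρρ * (θ i * θ j))

/-- `f` is smooth and `φ`-independent on `s`. -/
def IsSmoothAxisymmetricOn (f : E3 → ℝ) (s : Set E3) : Prop :=
  ContDiffOn ℝ ∞ f s ∧
  ∀ x ∈ s, ∀ y ∈ s, x 0 ^ 2 + x 1 ^ 2 = y 0 ^ 2 + y 1 ^ 2 → x 2 = y 2 → f x = f y

/-- Admissible data on `M = ℝ³ \ B(0, m₁/2)`. Smoothness up to the boundary is expressed by
smoothness on a slightly larger exterior region. -/
structure Admissible (m₁ : ℝ) (D : AxiData) : Prop where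
  regular : ∃ a : ℝ, 0 < a ∧ a < m₁ / 2 ∧
    IsSmoothAxisymmetricOn D.U {x | a < ‖x‖} ∧ IsSmoothAxisymmetricOn D.α {x | a < ‖x‖} ∧
    IsSmoothAxisymmetricOn D.B {x | a < ‖x‖} ∧ IsSmoothAxisymmetricOn D.A {x | a < ‖x‖} ∧
    ∀ x : E3, a < ‖x‖ → x 0 = 0 → x 1 = 0 → D.α x = 0
  falloff : ∃ k : ℕ, 5 ≤ k ∧
    (∀ i j, IsLittleOk k (-1 / 2) (fun x => D.metric x i j - (1 : Mat3) i j)) ∧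
    IsLittleOk (k - 3) (-1 / 2) D.U ∧ IsLittleOk (k - 4) (-1 / 2) D.α ∧
    IsLittleOk (k - 3) (-5 / 2) D.B ∧ IsLittleOk (k - 3) (-3 / 2) D.A
  deriv_sq_integrable : ∃ R : ℝ, ∀ l i j,
    MeasureTheory.MemLp (fun x => pd l (fun y => D.metric y i j) x) 2
      (MeasureTheory.volume.restrict {x : E3 | R < ‖x‖})
  scalarCurvature_nonneg : ∀ x ∈ exterior m₁, 0 ≤ scalarCurvature D.metric x
  outermost : HasOutermostMinimalBoundary m₁ D.metric

/-! ### The functional `J` -/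

/-- `∫_{∂B(0,R)} f dσ`. -/
def sphereIntegral (R : ℝ) (f : E3 → ℝ) : ℝ :=
  R ^ 2 * ∫ p : Metric.sphere (0 : E3) 1, f (R • (p : E3))
    ∂(MeasureTheory.volume : MeasureTheory.Measure E3).toSphere

/-- The volume integrand of `J_{Φ,Ψ}`. -/
def volumeIntegrand (Φ Ψ U : E3 → ℝ) (x : E3) : ℝ :=
  (1 / 2) * Φ x * ‖gradient U x + (1 / Φ x) • gradient (fun y => Φ y - Ψ y) x‖ ^ 2
    - 1 / (2 * Φ x) * ‖gradient (fun y => Φ y - Ψ y) x‖ ^ 2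

/-- The boundary integrand of `J_{Φ,Ψ}`. -/
def boundaryIntegrand (m₁ : ℝ) (Φ Ψ U α : E3 → ℝ) (x : E3) : ℝ :=
  2 / m₁ * Φ x + (1 / 2) * α x * (radialDeriv Φ x + 2 / m₁ * Φ x) - U x * radialDeriv Ψ x

/-- The functional `J_{Φ,Ψ}(U, α)`. -/
def J (m₁ : ℝ) (Φ Ψ U α : E3 → ℝ) : ℝ :=
  1 / (4 * Real.pi) * (∫ x in exterior m₁, volumeIntegrand Φ Ψ U x)
    + 1 / (4 * Real.pi) * sphereIntegral (m₁ / 2) (boundaryIntegrand m₁ Φ Ψ U α)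
    - Real.sqrt (1 / (16 * Real.pi) *
        sphereIntegral (m₁ / 2) (fun x => Real.exp (α x - 2 * U x)))

/-- `Φ_* = 1 - m₁² / (4 r²)`. -/
def PhiStar (m₁ : ℝ) (x : E3) : ℝ := 1 - m₁ ^ 2 / (4 * ‖x‖ ^ 2)

/-- `Ψ_* = - m₁ / r`. -/
def PsiStar (m₁ : ℝ) (x : E3) : ℝ := -(m₁ / ‖x‖)

/-- `U_S^{(k)} = -2 log [1 + (6k + m₁²)/(2 m₁ r) - k/(2 r²)]`. -/
def UEx (m₁ k : ℝ) (x : E3) : ℝ :=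
  -2 * Real.log (1 + (6 * k + m₁ ^ 2) / (2 * m₁ * ‖x‖) - k / (2 * ‖x‖ ^ 2))

/-- The data with `U_S = U_S^{(k)}` and `α_S ≡ B̄_S ≡ Ā_S ≡ 0`; its metric is
`e^{-2 U_S}` times the flat one. -/
def dataEx (m₁ k : ℝ) : AxiData where
  U := UEx m₁ k
  α := fun _ => 0
  B := fun _ => 0
  A := fun _ => 0

end AxiPenrose

end

/-!
The metric of the example is `u⁴ δ` with `u = 1 + b/r - c/r²`, `b = (6k + m₁²)/(2m₁)`, `c = k/2`.

*Scalar curvature and falloff.* By the conformal transformation law (`scalarCurvature_log`) the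
scalar curvature is `-8 u⁻⁵ Δu`, and `Δu = -k/r⁴` because `1/r` is harmonic. Both `U` and the
components of `g - δ` are analytic functions of `1/r` vanishing at infinity, so their `n`-th
derivatives are `O(r^{-1-n})` (`exists_bound_iteratedFDeriv_radial`).

*Outermost minimality.* The mean curvature of the sphere of radius `r` has the sign of
`u + 2 r u' = (1 - m₁/(2r)) (1 - 3k/(m₁ r))`, hence vanishes on `∂M` and is positive outside when
`k < m₁²/6`. A compact minimal surface touches from the inside the sphere through its farthest
point. There the comparison of second fundamental forms (`hessian_of_touching`) makes its mean
curvature, for the outward orientation, at least that of the sphere. Minimality thus forces the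
farthest point to lie on `∂M`. The surface is therefore contained in `∂M`, where its image is open
and closed (`range_eq_horizon`).

*Sign of `J`.* For `k = 0`, with `U₀ = -2 log (1 + m₁/(2r))`, the relation
`Φ_* U₀' = -(Φ_* - Ψ_*)'` holds, so that the volume density is exactly its value at `k = 0` plus
`½ Φ_* (U' - U₀')²` (`radialIntegrand_add_zerothDensity`). Since `u ≥ 1 + m₁/(2r)`, the difference
`U' - U₀'` is at most its first variation in `k`, which bounds the volume term by an elementary
integral. With `x = 2k/m₁²` the result is
`J/m₁ ≤ (8/5) x² + 2 log (1 + x) + 1 - (1 + x)²`; the terms of order zero and one cancel, and the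
coefficient `8/5 - 2` of `x²` is negative.
-/

namespace AxiPenrose
open Filter Topology MeasureTheory

/-! ### Partial derivatives -/

lemma pd_congr {f g : E3 → ℝ} {x : E3} (h : f =ᶠ[𝓝 x] g) (i : Fin 3) : pd i f x = pd i g x := by
  simp only [pd, h.fderiv_eq]

lemma HasFDerivAt.pd {f : E3 → ℝ} {f' : E3 →L[ℝ] ℝ} {x : E3} (h : HasFDerivAt f f' x)
    (i : Fin 3) : pd i f x = f' (EuclideanSpace.single i 1) := by
  rw [AxiPenrose.pd, h.fderiv]

lemma pd_const (c : ℝ) (i : Fin 3) (x : E3) : pd i (fun _ => c) x = 0 := by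
  simp [pd]

lemma pd_mul {f g : E3 → ℝ} {x : E3} (hf : DifferentiableAt ℝ f x) (hg : DifferentiableAt ℝ g x)
    (i : Fin 3) : pd i (fun y => f y * g y) x = f x * pd i g x + g x * pd i f x := by
  exact (HasFDerivAt.pd (hf.hasFDerivAt.mul hg.hasFDerivAt) i).trans (by simp [pd])

lemma pd_const_mul {f : E3 → ℝ} {x : E3} (c : ℝ) (hf : DifferentiableAt ℝ f x) (i : Fin 3) :
    pd i (fun y => c * f y) x = c * pd i f x := by
  rw [HasFDerivAt.pd (hf.hasFDerivAt.const_mul c)]; simp [pd]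

/-- Chain rule for a function of one real variable. -/
lemma pd_comp {h : ℝ → ℝ} {h' : ℝ} {f : E3 → ℝ} {x : E3} (hh : HasDerivAt h h' (f x))
    (hf : DifferentiableAt ℝ f x) (i : Fin 3) : pd i (fun y => h (f y)) x = h' * pd i f x := by
  exact (HasFDerivAt.pd (hh.comp_hasFDerivAt x hf.hasFDerivAt) i).trans (by simp [pd])

lemma differentiableAt_coord (j : Fin 3) (x : E3) : DifferentiableAt ℝ (fun y : E3 => y j) x := by
  fun_prop

lemma pd_coord (i j : Fin 3) (x : E3) : pd i (fun y => y j) x = if i = j then 1 else 0 := by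
  have h : HasFDerivAt (fun y : E3 => y j) (EuclideanSpace.proj (𝕜 := ℝ) j) x :=
    (EuclideanSpace.proj (𝕜 := ℝ) j).hasFDerivAt
  rw [HasFDerivAt.pd h]
  simp [eq_comm]

lemma contDiffAt_pd {f : E3 → ℝ} {x : E3} {n m : WithTop ℕ∞} (hf : ContDiffAt ℝ n f x)
    (hmn : m + 1 ≤ n) (i : Fin 3) : ContDiffAt ℝ m (pd i f) x :=
  (hf.fderiv_right hmn).clm_apply contDiffAt_const

lemma differentiableAt_pd {f : E3 → ℝ} {x : E3} (hf : ContDiffAt ℝ 2 f x) (i : Fin 3) :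
    DifferentiableAt ℝ (pd i f) x :=
  (contDiffAt_pd (m := 1) hf (by norm_num) i).differentiableAt (by norm_num)

lemma norm_sq_eq_sum (x : E3) : ‖x‖ ^ 2 = ∑ i, x i ^ 2 := by
  rw [EuclideanSpace.norm_sq_eq]; simp

lemma hasFDerivAt_norm {x : E3} (hx : x ≠ 0) :
    HasFDerivAt (fun y : E3 => ‖y‖) (‖x‖⁻¹ • innerSL ℝ x) x := by
  have h1 : HasFDerivAt (fun y : E3 => ‖y‖ ^ 2) (2 • innerSL ℝ x) x := by
    simpa using (hasFDerivAt_id (𝕜 := ℝ) x).norm_sq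
  have h2 := h1.sqrt (by positivity)
  simp only [Real.sqrt_sq (norm_nonneg _)] at h2
  have h3 : (1 / (2 * ‖x‖)) • 2 • innerSL ℝ x = ‖x‖⁻¹ • innerSL ℝ x := by
    have : ‖x‖ ≠ 0 := norm_ne_zero_iff.2 hx
    ext v
    simp
    field_simp
  rwa [h3] at h2

lemma differentiableAt_norm' {x : E3} (hx : x ≠ 0) :
    DifferentiableAt ℝ (fun y : E3 => ‖y‖) x := (hasFDerivAt_norm hx).differentiableAt

lemma pd_norm {x : E3} (hx : x ≠ 0) (i : Fin 3) : pd i (fun y => ‖y‖) x = x i / ‖x‖ := by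
  rw [HasFDerivAt.pd (hasFDerivAt_norm hx)]
  simp [EuclideanSpace.inner_single_right, div_eq_inv_mul]

lemma pd_radial {φ : ℝ → ℝ} {φ' : ℝ} {x : E3} (hx : x ≠ 0) (h : HasDerivAt φ φ' ‖x‖) (i : Fin 3) :
    pd i (fun y => φ ‖y‖) x = φ' * (x i / ‖x‖) := by
  rw [pd_comp (f := fun y => ‖y‖) h (differentiableAt_norm' hx), pd_norm hx]

/-! ### Scalar curvature of conformally flat metrics -/

/-- The conformally flat metric `w δ`. -/
noncomputable def conformalMetric (w : E3 → ℝ) (x : E3) : Mat3 := w x • (1 : Mat3)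

lemma conformalMetric_inv {w : E3 → ℝ} {x : E3} (hw : w x ≠ 0) :
    (conformalMetric w x)⁻¹ = (w x)⁻¹ • (1 : Mat3) := by
  refine Matrix.inv_eq_left_inv ?_
  simp [conformalMetric, smul_smul, hw]

lemma christoffel_conformal {U : E3 → ℝ} {x : E3} (hU : DifferentiableAt ℝ U x) (k i j : Fin 3) :
    christoffel (conformalMetric fun y => Real.exp (-2 * U y)) k i j x =
      -((1 : Mat3) j k * pd i U x + (1 : Mat3) i k * pd j U x - (1 : Mat3) i j * pd k U x) := by
  have hpd : ∀ a b c : Fin 3,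
      pd a (fun y => conformalMetric (fun y => Real.exp (-2 * U y)) y b c) x
        = Real.exp (-2 * U x) * (-2 * (1 : Mat3) b c * pd a U x) := by
    intro a b c
    have h1 : HasFDerivAt (fun y => Real.exp (-2 * U y) * (1 : Mat3) b c)
        (((1 : Mat3) b c) • (Real.exp (-2 * U x) • ((-2 : ℝ) • fderiv ℝ U x))) x :=
      ((hU.hasFDerivAt.const_mul (-2)).exp).mul_const _
    have h2 := HasFDerivAt.pd h1 a
    simp only [conformalMetric, Matrix.smul_apply, smul_eq_mul]
    rw [h2]; simp [pd]; ring
  simp only [christoffel, hpd]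
  rw [conformalMetric_inv (Real.exp_pos _).ne']
  have he : Real.exp (-2 * U x) ≠ 0 := (Real.exp_pos _).ne'
  rw [Finset.sum_eq_single k]
  · simp only [Matrix.smul_apply, Matrix.one_apply_eq, smul_eq_mul]
    field_simp
    ring
  · intro l _ hl
    simp [Matrix.one_apply_ne' hl]
  · simp

/-- The conformal transformation law of the scalar curvature in dimension three, for `e^{-2U} δ`. -/
lemma scalarCurvature_conformal {U : E3 → ℝ} {x : E3} (hU : ContDiffAt ℝ 2 U x) :
    scalarCurvature (conformalMetric fun y => Real.exp (-2 * U y)) x =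
      Real.exp (2 * U x) * (4 * ∑ i, pd i (pd i U) x - 2 * ∑ i, pd i U x ^ 2) := by
  have hev : ∀ᶠ y in 𝓝 x, DifferentiableAt ℝ U y := by
    filter_upwards [hU.eventually (by simp)] with y hy using hy.differentiableAt (by norm_num)
  have hΓ : ∀ k i j, christoffel (conformalMetric fun y => Real.exp (-2 * U y)) k i j =ᶠ[𝓝 x]
      fun y => -((1 : Mat3) j k * pd i U y + (1 : Mat3) i k * pd j U y
        - (1 : Mat3) i j * pd k U y) := fun k i j => by
    filter_upwards [hev] with y hy using christoffel_conformal hy k i j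
  have hdd := differentiableAt_pd hU
  have hpd : ∀ l k i j, pd l (christoffel (conformalMetric fun y => Real.exp (-2 * U y)) k i j) x =
      -((1 : Mat3) j k * pd l (pd i U) x + (1 : Mat3) i k * pd l (pd j U) x
        - (1 : Mat3) i j * pd l (pd k U) x) := by
    intro l k i j
    rw [pd_congr (hΓ k i j)]
    have := HasFDerivAt.pd (((((hdd i).hasFDerivAt.const_mul ((1 : Mat3) j k)).add
      ((hdd j).hasFDerivAt.const_mul ((1 : Mat3) i k))).sub
      ((hdd k).hasFDerivAt.const_mul ((1 : Mat3) i j))).neg) l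
    exact this.trans (by simp [pd])
  have hΓx : ∀ k i j, christoffel (conformalMetric fun y => Real.exp (-2 * U y)) k i j x =
      -((1 : Mat3) j k * pd i U x + (1 : Mat3) i k * pd j U x
        - (1 : Mat3) i j * pd k U x) := fun k i j => (hΓ k i j).self_of_nhds
  simp only [scalarCurvature, ricci, hpd, hΓx]
  rw [conformalMetric_inv (Real.exp_pos _).ne', ← Real.exp_neg]
  simp only [Fin.sum_univ_three, Matrix.smul_apply, Matrix.one_apply, smul_eq_mul]
  simp
  ring

/-- The scalar curvature of `u⁴ δ` is `-8 u⁻⁵ Δu`. -/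
lemma scalarCurvature_log {u : E3 → ℝ} {x : E3} (hu : ContDiffAt ℝ 2 u x) (hpos : 0 < u x) :
    scalarCurvature (conformalMetric fun y => Real.exp (-2 * (-2 * Real.log (u y)))) x =
      -8 / u x ^ 5 * ∑ i, pd i (pd i u) x := by
  have hev : ∀ᶠ y in 𝓝 x, DifferentiableAt ℝ u y ∧ u y ≠ 0 := by
    filter_upwards [hu.eventually (by simp), hu.continuousAt.eventually_ne hpos.ne'] with y hy hy'
      using ⟨hy.differentiableAt (by norm_num), hy'⟩
  have hpd : ∀ i, pd i (fun y => -2 * Real.log (u y)) =ᶠ[𝓝 x]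
      fun y => -2 * (pd i u y * (u y)⁻¹) := by
    intro i
    filter_upwards [hev] with y hy
    have h := HasFDerivAt.pd ((hy.1.hasFDerivAt.log hy.2).const_mul (-2)) i
    exact h.trans (by simp [pd]; ring)
  have hdd := differentiableAt_pd hu
  have hpd2 : ∀ i, pd i (pd i (fun y => -2 * Real.log (u y))) x =
      -2 * (pd i (pd i u) x * (u x)⁻¹ - pd i u x ^ 2 * (u x ^ 2)⁻¹) := by
    intro i
    rw [pd_congr (hpd i)]
    have h0 : HasFDerivAt (fun y => (u y)⁻¹) (-(u x ^ 2)⁻¹ • fderiv ℝ u x) x :=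
      (hasDerivAt_inv hpos.ne').comp_hasFDerivAt x hev.self_of_nhds.1.hasFDerivAt
    have h := HasFDerivAt.pd (((hdd i).hasFDerivAt.mul h0).const_mul (-2)) i
    exact h.trans (by simp [pd]; ring)
  rw [scalarCurvature_conformal (contDiffAt_const.mul (hu.log hpos.ne'))]
  simp only [hpd2, fun i => (hpd i).self_of_nhds]
  have hexp : Real.exp (2 * (-2 * Real.log (u x))) = (u x ^ 4)⁻¹ := by
    rw [show 2 * (-2 * Real.log (u x)) = -Real.log (u x ^ 4) by rw [Real.log_pow]; push_cast; ring,
      Real.exp_neg, Real.exp_log (by positivity)]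
  rw [hexp]
  simp only [Fin.sum_univ_three]
  field_simp
  ring

/-! ### Decay at infinity -/

lemma contDiffAt_inv_norm {x : E3} (hx : x ≠ 0) (n : WithTop ℕ∞) :
    ContDiffAt ℝ n (fun y : E3 => ‖y‖⁻¹) x :=
  (contDiffAt_norm ℝ hx).inv (norm_ne_zero_iff.2 hx)

/-- The `n`-th derivative of `1/r` is homogeneous of degree `-1-n`. -/
lemma norm_iteratedFDeriv_inv_norm_smul (n : ℕ) {c : ℝ} (hc : 0 < c) {x : E3} (hx : x ≠ 0) :
    ‖iteratedFDeriv ℝ n (fun y : E3 => ‖y‖⁻¹) (c • x)‖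
      = c⁻¹ ^ (n + 1) * ‖iteratedFDeriv ℝ n (fun y : E3 => ‖y‖⁻¹) x‖ := by
  set f : E3 → ℝ := fun y => ‖y‖⁻¹ with hf
  let g : E3 ≃L[ℝ] E3 := ContinuousLinearEquiv.smulLeft (Units.mk0 c hc.ne')
  have hg : ∀ y, g y = c • y := fun y => rfl
  have h1 : iteratedFDeriv ℝ n (f ∘ g) x =
      (iteratedFDeriv ℝ n f (g x)).compContinuousLinearMap fun _ => (g : E3 →L[ℝ] E3) := by
    have := g.iteratedFDerivWithin_comp_right f uniqueDiffOn_univ (x := x) (Set.mem_univ _) n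
    simpa [iteratedFDerivWithin_univ] using this
  have h2 : f ∘ g = c⁻¹ • f := by
    ext y
    simp [hf, hg, norm_smul, abs_of_pos hc, mul_comm]
  have h3 : iteratedFDeriv ℝ n (c⁻¹ • f) x = c⁻¹ • iteratedFDeriv ℝ n f x :=
    iteratedFDeriv_const_smul_apply (contDiffAt_inv_norm hx n)
  have h4 : (iteratedFDeriv ℝ n f (g x)).compContinuousLinearMap (fun _ => (g : E3 →L[ℝ] E3))
      = c ^ n • iteratedFDeriv ℝ n f (g x) := by
    ext v
    have : (fun i => (g : E3 →L[ℝ] E3) (v i)) = fun i => (fun _ => c) i • v i := by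
      ext i; simp [hg]
    simp only [ContinuousMultilinearMap.compContinuousLinearMap_apply,
      smul_apply]
    rw [this, ContinuousMultilinearMap.map_smul_univ]
    simp
  rw [h2, h3, h4, hg] at h1
  have h5 := congrArg norm h1
  rw [norm_smul, norm_smul, Real.norm_of_nonneg (by positivity),
    Real.norm_of_nonneg (by positivity)] at h5
  rw [pow_succ, mul_assoc, h5, ← mul_assoc, ← mul_pow, inv_mul_cancel₀ hc.ne', one_pow, one_mul]

lemma exists_bound_iteratedFDeriv_inv_norm (n : ℕ) :
    ∃ C : ℝ, 0 ≤ C ∧ ∀ x : E3, x ≠ 0 →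
      ‖iteratedFDeriv ℝ n (fun y : E3 => ‖y‖⁻¹) x‖ ≤ C * ‖x‖⁻¹ ^ (n + 1) := by
  have hcont : ContinuousOn (iteratedFDeriv ℝ n (fun y : E3 => ‖y‖⁻¹)) (Metric.sphere 0 1) := by
    intro x hx
    have hx0 : x ≠ 0 := by rintro rfl; simp at hx
    exact ((contDiffAt_inv_norm hx0 (n + 1 : ℕ)).differentiableAt_iteratedFDeriv
      (by exact_mod_cast Nat.lt_succ_self n)).continuousAt.continuousWithinAt
  obtain ⟨C, hC⟩ := (isCompact_sphere (0 : E3) 1).exists_bound_of_continuousOn hcont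
  refine ⟨max C 0, le_max_right _ _, fun x hx => ?_⟩
  have hn : 0 < ‖x‖ := norm_pos_iff.2 hx
  have h := norm_iteratedFDeriv_inv_norm_smul n hn (x := ‖x‖⁻¹ • x) (by simp [hx])
  rw [smul_smul, mul_inv_cancel₀ hn.ne', one_smul] at h
  rw [h, mul_comm]
  gcongr
  exact (hC _ (by simp [norm_smul, hn.ne'])).trans (le_max_left _ _)

/-- Chain rule bound for the derivatives of `q (1/r)`; it misses the decay of `q` itself. -/
lemma exists_bound_iteratedFDeriv_comp {q : ℝ → ℝ} {n : ℕ} (hq : ContDiffAt ℝ n q 0) :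
    ∃ C R : ℝ, 0 ≤ C ∧ 1 ≤ R ∧ (∀ x : E3, R < ‖x‖ → ContDiffAt ℝ n (fun y : E3 => q ‖y‖⁻¹) x) ∧
      ∀ x : E3, R < ‖x‖ →
      ‖iteratedFDeriv ℝ n (fun y : E3 => q ‖y‖⁻¹) x‖ ≤ C * ‖x‖⁻¹ ^ n := by
  -- a neighbourhood of `0` on which `q` is smooth, with bounded derivatives
  have hev : ∀ᶠ t in 𝓝 (0 : ℝ), ContDiffAt ℝ n q t ∧
      ∀ i ∈ Finset.range (n + 1), ‖iteratedFDeriv ℝ i q t‖ < ‖iteratedFDeriv ℝ i q 0‖ + 1 := by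
    refine (hq.eventually (by simp)).and ((Filter.eventually_all_finset _).2 fun i hi => ?_)
    have : ContinuousAt (iteratedFDeriv ℝ i q) 0 :=
      hq.continuousAt_iteratedFDeriv (by exact_mod_cast Nat.lt_succ_iff.1 (Finset.mem_range.1 hi))
    exact this.norm.eventually_lt_const (lt_add_one _)
  obtain ⟨δ, hδ, hball⟩ := Metric.eventually_nhds_iff_ball.1 hev
  set Cq : ℝ := ∑ i ∈ Finset.range (n + 1), (‖iteratedFDeriv ℝ i q 0‖ + 1)
  choose K hK0 hK using exists_bound_iteratedFDeriv_inv_norm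
  set D : ℝ := 1 + ∑ i ∈ Finset.range (n + 1), K i
  have hD1 : 1 ≤ D := by
    have : 0 ≤ ∑ i ∈ Finset.range (n + 1), K i := Finset.sum_nonneg fun i _ => hK0 i
    simp only [D]; linarith
  have hR : ∀ x : E3, max 1 δ⁻¹ < ‖x‖ → 1 < ‖x‖ ∧ ‖x‖⁻¹ ∈ Metric.ball (0 : ℝ) δ := by
    intro x hx
    have h1 := (le_max_left _ _).trans_lt hx
    have h2 := (le_max_right _ _).trans_lt hx
    refine ⟨h1, ?_⟩
    rw [mem_ball_zero_iff, norm_inv, norm_norm]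
    exact inv_lt_of_inv_lt₀ hδ h2
  have hopen : IsOpen {x : E3 | max 1 δ⁻¹ < ‖x‖} := isOpen_lt continuous_const continuous_norm
  have hne : ∀ x : E3, max 1 δ⁻¹ < ‖x‖ → x ≠ 0 := by
    rintro x hx rfl
    have := (hR _ hx).1
    simp at this
    linarith
  refine ⟨n.factorial * Cq * D ^ n, max 1 δ⁻¹, ?_, le_max_left _ _, ?_, ?_⟩
  · have : 0 ≤ Cq := Finset.sum_nonneg fun i _ => by positivity
    positivity
  · intro x hx
    exact ((hball _ (hR x hx).2).1).comp x (contDiffAt_inv_norm (hne x hx) n)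
  · intro x hx
    have h := norm_iteratedFDerivWithin_comp_le (𝕜 := ℝ) (g := q) (f := fun y : E3 => ‖y‖⁻¹)
      (n := n) (s := {x : E3 | max 1 δ⁻¹ < ‖x‖}) (t := Metric.ball 0 δ) (x := x) (N := n)
      (fun t ht => (hball t ht).1.contDiffWithinAt)
      (fun y hy => (contDiffAt_inv_norm (hne y hy) n).contDiffWithinAt) le_rfl
      Metric.isOpen_ball.uniqueDiffOn hopen.uniqueDiffOn (fun y hy => (hR y hy).2) hx
      (C := Cq) (D := D * ‖x‖⁻¹) ?_ ?_
    · rw [iteratedFDerivWithin_of_isOpen n hopen hx, mul_pow, ← mul_assoc] at h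
      exact h
    · intro i hi
      rw [iteratedFDerivWithin_of_isOpen i Metric.isOpen_ball (hR x hx).2]
      have hi' : i ∈ Finset.range (n + 1) := Finset.mem_range.2 (by omega)
      exact ((hball _ (hR x hx).2).2 i hi').le.trans
        (Finset.single_le_sum (f := fun i => ‖iteratedFDeriv ℝ i q 0‖ + 1)
          (fun j _ => by positivity) hi')
    · intro i hi1 hi
      rw [iteratedFDerivWithin_of_isOpen i hopen hx, mul_pow]
      have hi' : i ∈ Finset.range (n + 1) := Finset.mem_range.2 (by omega)
      have hKD : K i ≤ D := by
        have := Finset.single_le_sum (f := K) (fun j _ => hK0 j) hi'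
        simp only [D]; linarith
      have hr : ‖x‖⁻¹ ≤ 1 := inv_le_one_of_one_le₀ (hR x hx).1.le
      calc _ ≤ K i * ‖x‖⁻¹ ^ (i + 1) := hK i x (hne x hx)
        _ ≤ D ^ i * ‖x‖⁻¹ ^ i := by
          gcongr ?_ * ?_
          · exact hKD.trans (le_self_pow₀ hD1 (by omega))
          · exact pow_le_pow_of_le_one (by positivity) hr (Nat.le_succ i)

/-- If `q` is analytic at `0` and `q 0 = 0`, then the `n`-th derivative of `q (1/r)` is
`O(r^{-1-n})`: one factor `1/r` is split off, and the derivatives of what remains are controlled by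
the chain rule. -/
lemma exists_bound_iteratedFDeriv_radial {q : ℝ → ℝ} (hq : AnalyticAt ℝ q 0) (hq0 : q 0 = 0)
    (n : ℕ) : ∃ C R : ℝ, 0 ≤ C ∧ 1 ≤ R ∧ ∀ x : E3, R < ‖x‖ →
      ‖iteratedFDeriv ℝ n (fun y : E3 => q ‖y‖⁻¹) x‖ ≤ C * ‖x‖⁻¹ ^ (n + 1) := by
  obtain ⟨p, hp⟩ := hq
  have hd : ∀ m : ℕ, ContDiffAt ℝ m (dslope q 0) 0 := fun m =>
    (AnalyticAt.contDiffAt ⟨_, hp.has_fpower_series_dslope_fslope⟩)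
  choose C R hC hR1 hcd hCR using fun m : ℕ => exists_bound_iteratedFDeriv_comp (hd m)
  choose K hK0 hK using exists_bound_iteratedFDeriv_inv_norm
  set R' : ℝ := 1 + ∑ i ∈ Finset.range (n + 1), R i
  have hRle : ∀ i ≤ n, R i ≤ R' := fun i hi => by
    have := Finset.single_le_sum (f := R) (s := Finset.range (n + 1))
      (fun j _ => zero_le_one.trans (hR1 j)) (Finset.mem_range.2 (show i < n + 1 by omega))
    simp only [R']; linarith
  have hR'1 : 1 ≤ R' := (hR1 0).trans (hRle 0 (by omega))
  have hopen : IsOpen {x : E3 | R' < ‖x‖} := isOpen_lt continuous_const continuous_norm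
  have hne : ∀ x : E3, R' < ‖x‖ → x ≠ 0 := by
    rintro x hx rfl
    simp at hx; linarith
  have heq : (fun y : E3 => q ‖y‖⁻¹) = fun y => ‖y‖⁻¹ * dslope q 0 ‖y‖⁻¹ := by
    ext y
    have := sub_smul_dslope q 0 ‖y‖⁻¹
    simpa [hq0] using this.symm
  refine ⟨∑ i ∈ Finset.range (n + 1), (n.choose i : ℝ) * K i * C (n - i), R', ?_, hR'1, ?_⟩
  · exact Finset.sum_nonneg fun i _ => by
      have := hK0 i; have := hC (n - i); positivity
  intro x hx
  rw [heq]
  have h := norm_iteratedFDerivWithin_mul_le (𝕜 := ℝ) (f := fun y : E3 => ‖y‖⁻¹)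
    (g := fun y : E3 => dslope q 0 ‖y‖⁻¹) (N := n) (s := {x : E3 | R' < ‖x‖})
    (fun y hy => (contDiffAt_inv_norm (hne y hy) n).contDiffWithinAt)
    (fun y hy => (hcd n y ((hRle n le_rfl).trans_lt hy)).contDiffWithinAt)
    hopen.uniqueDiffOn hx (n := n) le_rfl
  rw [iteratedFDerivWithin_of_isOpen n hopen hx] at h
  refine h.trans ?_
  rw [Finset.sum_mul]
  refine Finset.sum_le_sum fun i hi => ?_
  have hin : i ≤ n := by simpa [Nat.lt_succ_iff] using hi
  rw [iteratedFDerivWithin_of_isOpen _ hopen hx, iteratedFDerivWithin_of_isOpen _ hopen hx]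
  have h1 := hK i x (hne x hx)
  have h2 := hCR (n - i) x ((hRle (n - i) (by omega)).trans_lt hx)
  calc _ ≤ (n.choose i : ℝ) * (K i * ‖x‖⁻¹ ^ (i + 1)) * (C (n - i) * ‖x‖⁻¹ ^ (n - i)) := by
        have := hK0 i
        gcongr
    _ = _ := by
        rw [show n + 1 = (i + 1) + (n - i) by omega, pow_add]
        ring

lemma isLittleOk_radial {q : ℝ → ℝ} (hq : AnalyticAt ℝ q 0) (hq0 : q 0 = 0) (k : ℕ) :
    IsLittleOk k (-1 / 2) (fun x => q ‖x‖⁻¹) := by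
  intro l _
  obtain ⟨C, R, hC, hR1, hb⟩ := exists_bound_iteratedFDeriv_radial hq hq0 l
  have hO : (fun x => iteratedFDeriv ℝ l (fun x : E3 => q ‖x‖⁻¹) x)
      =O[Bornology.cobounded E3] fun x => ‖x‖ ^ (-(l + 1 : ℝ)) := by
    refine Asymptotics.IsBigO.of_bound C ?_
    filter_upwards [tendsto_norm_cobounded_atTop.eventually_gt_atTop R] with x hx
    refine (hb x hx).trans_eq ?_
    rw [Real.norm_of_nonneg (by positivity), Real.rpow_neg (by positivity), inv_pow]
    norm_cast
  refine hO.trans_isLittleO ?_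
  have hlt : (fun r : ℝ => r ^ (-(l + 1 : ℝ))) =o[atTop] fun r => r ^ (-1 / 2 - (l : ℝ)) := by
    rw [Asymptotics.isLittleO_iff_tendsto']
    · refine (tendsto_rpow_neg_atTop (y := 1 / 2) (by norm_num)).congr' ?_
      filter_upwards [eventually_gt_atTop 0] with r hr
      rw [← Real.rpow_sub hr]
      ring_nf
    · filter_upwards [eventually_gt_atTop 0] with r hr h
      exact absurd h (by positivity)
  exact hlt.comp_tendsto tendsto_norm_cobounded_atTop

lemma isLittleOk_zero (k : ℕ) (μ : ℝ) : IsLittleOk k μ (fun _ => 0) := by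
  intro l _
  have : (fun x : E3 => iteratedFDeriv ℝ l (fun _ : E3 => (0 : ℝ)) x) = fun _ => 0 := by
    ext x; simp
  rw [this]
  exact Asymptotics.isLittleO_zero _ _

/-- The first derivatives of `q (1/r)` are square integrable near infinity. -/
lemma exists_memLp_pd_radial {q : ℝ → ℝ} (hq : AnalyticAt ℝ q 0) (hq0 : q 0 = 0) :
    ∃ R : ℝ, ∀ l, MeasureTheory.MemLp (pd l fun x => q ‖x‖⁻¹) 2
      (MeasureTheory.volume.restrict {x : E3 | R < ‖x‖}) := by
  obtain ⟨C, R, hC, hR1, hb⟩ := exists_bound_iteratedFDeriv_radial hq hq0 1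
  refine ⟨R, fun l => ?_⟩
  have hmeas : Measurable (pd l fun x => q ‖x‖⁻¹) := measurable_fderiv_apply_const ℝ _ _
  rw [MeasureTheory.memLp_two_iff_integrable_sq hmeas.aestronglyMeasurable]
  have hint : MeasureTheory.IntegrableOn (fun x : E3 => (16 * C ^ 2) * (1 + ‖x‖) ^ (-(4 : ℝ)))
      {x : E3 | R < ‖x‖} :=
    ((integrable_one_add_norm (by simp; norm_num)).const_mul _).integrableOn
  refine hint.mono' (hmeas.pow_const 2).aestronglyMeasurable ?_
  refine (MeasureTheory.ae_restrict_iff' (measurableSet_lt measurable_const measurable_norm)).2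
    (Eventually.of_forall fun x hx => ?_)
  have hx : R < ‖x‖ := hx
  have h1 := hb x hx
  rw [norm_iteratedFDeriv_one] at h1
  have h2 : ‖pd l (fun x => q ‖x‖⁻¹) x‖ ≤ C * ‖x‖⁻¹ ^ 2 := by
    refine (ContinuousLinearMap.le_opNorm _ _).trans ?_
    simpa using h1
  have h3 : ‖x‖⁻¹ ≤ 2 * (1 + ‖x‖)⁻¹ := by
    rw [← div_eq_mul_inv, inv_eq_one_div, div_le_div_iff₀ (by linarith) (by positivity)]
    linarith
  rw [norm_pow]
  calc _ ≤ (C * ‖x‖⁻¹ ^ 2) ^ 2 := by gcongr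
    _ ≤ (C * (2 * (1 + ‖x‖)⁻¹) ^ 2) ^ 2 := by gcongr
    _ = _ := by
      rw [Real.rpow_neg (by positivity)]
      norm_cast
      field_simp
      ring

/-! ### Mean curvature of level sets -/

/-- In the conformally flat metric `w δ` the mean curvature of a level set is
`w^{-3/2} div (w ∇F / |∇F|)`; this is its value at a point where the flat gradient of `F` is the
multiple `c x` of the position vector. -/
lemma levelMeanCurvature_conformal {w F : E3 → ℝ} {x : E3} {c : ℝ} (hw : DifferentiableAt ℝ w x)
    (hwpos : 0 < w x) (hF : ContDiffAt ℝ 2 F x) (hc : c ≠ 0) (hx : x ≠ 0)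
    (hgrad : ∀ i, pd i F x = c * x i) :
    levelMeanCurvature (conformalMetric w) F x =
      (Real.sqrt (w x ^ 3))⁻¹ * ((|c| * ‖x‖)⁻¹ * (c * ∑ i, x i * pd i w x +
        w x * (∑ i, pd i (pd i F) x - (‖x‖ ^ 2)⁻¹ * ∑ i, ∑ j, x i * x j * pd i (pd j F) x))) := by
  set S : E3 → ℝ := fun y => ∑ j, pd j F y ^ 2 with hS
  have hdd := differentiableAt_pd hF
  have hSx : S x = (|c| * ‖x‖) ^ 2 := by
    simp only [hS, hgrad, mul_pow, ← Finset.mul_sum, sq_abs, norm_sq_eq_sum]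
  have hN : 0 < |c| * ‖x‖ := by positivity
  have hSpos : 0 < S x := by rw [hSx]; positivity
  have hSd : DifferentiableAt ℝ S x := by
    refine DifferentiableAt.fun_sum fun j _ => (hdd j).pow 2
  have hpdS : ∀ i, pd i S x = ∑ j, 2 * (c * x j) * pd i (pd j F) x := by
    intro i
    have h : HasFDerivAt S (∑ j, (2 * pd j F x ^ 1) • fderiv ℝ (pd j F) x) x :=
      HasFDerivAt.fun_sum fun j _ => by simpa using (hdd j).hasFDerivAt.pow 2
    rw [HasFDerivAt.pd h]
    simp [pd, ← hgrad]
  have hev : ∀ i, (fun y => Real.sqrt (conformalMetric w y).det *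
      (metricGrad (conformalMetric w) F i y / metricGradNorm (conformalMetric w) F y)) =ᶠ[𝓝 x]
      fun y => w y * (pd i F y * (Real.sqrt (S y))⁻¹) := by
    intro i
    filter_upwards [hw.continuousAt.eventually_const_lt hwpos,
      hSd.continuousAt.eventually_const_lt hSpos] with y hwy hSy
    have hdet : (conformalMetric w y).det = w y ^ 3 := by simp [conformalMetric]
    have hmg : ∀ k, metricGrad (conformalMetric w) F k y = (w y)⁻¹ * pd k F y := by
      intro k
      simp [metricGrad, conformalMetric_inv hwy.ne', Matrix.one_apply, mul_comm]
    have hmn : metricGradNorm (conformalMetric w) F y = Real.sqrt ((w y)⁻¹ * S y) := by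
      simp only [metricGradNorm, hmg, hS, Finset.mul_sum]
      congr 1
      exact Finset.sum_congr rfl fun k _ => by ring
    rw [hdet, hmg, hmn, Real.sqrt_mul (by positivity), Real.sqrt_inv,
      show w y ^ 3 = w y ^ 2 * w y by ring, Real.sqrt_mul (by positivity), Real.sqrt_sq hwy.le]
    have h1 : Real.sqrt (w y) ≠ 0 := by positivity
    have h2 : Real.sqrt (S y) ≠ 0 := by positivity
    have h3 : Real.sqrt (w y) ^ 2 = w y := Real.sq_sqrt hwy.le
    field_simp
    rw [h3]
  have hinv : HasDerivAt (fun t : ℝ => (Real.sqrt t)⁻¹)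
      (-(1 / (2 * Real.sqrt (S x))) / Real.sqrt (S x) ^ 2) (S x) :=
    (Real.hasDerivAt_sqrt hSpos.ne').inv (by positivity)
  have hsd : DifferentiableAt ℝ (fun y => (Real.sqrt (S y))⁻¹) x :=
    (hinv.comp_hasFDerivAt x hSd.hasFDerivAt).differentiableAt
  have hpd : ∀ i, pd i (fun y => Real.sqrt (conformalMetric w y).det *
      (metricGrad (conformalMetric w) F i y / metricGradNorm (conformalMetric w) F y)) x =
      (|c| * ‖x‖)⁻¹ * (c * (x i * pd i w x) + w x * (pd i (pd i F) x
        - (‖x‖ ^ 2)⁻¹ * ∑ j, x i * x j * pd i (pd j F) x)) := by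
    intro i
    rw [pd_congr (hev i), pd_mul hw ((hdd i).fun_mul hsd), pd_mul (hdd i) hsd, pd_comp hinv hSd,
      hpdS, hgrad, hSx, Real.sqrt_sq hN.le]
    simp only [Fin.sum_univ_three]
    have hc2 : |c| ^ 2 = c ^ 2 := sq_abs c
    have hc0 : |c| ≠ 0 := by positivity
    have hx0 : ‖x‖ ≠ 0 := by positivity
    field_simp
    rw [hc2]
    field_simp
    ring
  have hdet : (conformalMetric w x).det = w x ^ 3 := by simp [conformalMetric]
  simp only [levelMeanCurvature, hpd, hdet, Fin.sum_univ_three]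
  ring

/-! ### Surfaces touching a sphere from the inside -/

/-- If the zero set of `F` lies in the ball of radius `|x₀|` and touches its boundary at `x₀`, then
the flat gradient of `F` at `x₀` is radial (Lagrange multipliers). -/
lemma fderiv_eq_of_touching {F : E3 → ℝ} {x₀ : E3} {V : Set E3} (hV : V ∈ 𝓝 x₀)
    (hF : ContDiffAt ℝ 2 F x₀) (hF0 : F x₀ = 0) (hdF : fderiv ℝ F x₀ ≠ 0) (hx₀ : x₀ ≠ 0)
    (hmax : ∀ x ∈ V, F x = 0 → ‖x‖ ≤ ‖x₀‖) :
    ∃ c : ℝ, c ≠ 0 ∧ fderiv ℝ F x₀ = c • innerSL ℝ x₀ := by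
  have hext : IsLocalExtrOn (fun x : E3 => ‖x‖ ^ 2) {x | F x = F x₀} x₀ := by
    refine Or.inr ?_
    filter_upwards [mem_nhdsWithin_of_mem_nhds hV, self_mem_nhdsWithin] with x hx hFx
    have := hmax x hx (by rw [hFx, hF0])
    gcongr
  obtain ⟨a, b, hab, h⟩ := hext.exists_multipliers_of_hasStrictFDerivAt_1d
    (hF.hasStrictFDerivAt (by norm_num)) (hasStrictFDerivAt_norm_sq x₀)
  have ha : a ≠ 0 := by
    rintro rfl
    have hb : b ≠ 0 := by rintro rfl; exact hab rfl
    have := congrArg (fun L => L x₀) h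
    simp [hb, hx₀] at this
  have hb : b ≠ 0 := by
    rintro rfl
    simp [ha, hdF] at h
  refine ⟨-(2 * b / a), by simp [ha, hb], ?_⟩
  ext v
  have hv := congrArg (fun L => L v) h
  simp at hv ⊢
  field_simp
  linarith

/-- On a ray through a point near `x₀`, `F` changes sign when its radial derivative at `x₀` is
positive. -/
lemma eventually_pos_neg_on_rays {F : E3 → ℝ} {x₀ : E3} (hF : ContDiffAt ℝ 2 F x₀)
    {V : Set E3} (hV : IsOpen V) (hxV : x₀ ∈ V) (hFV : ContinuousOn F V)
    (hF0 : F x₀ = 0) (hrad : 0 < fderiv ℝ F x₀ x₀) :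
    ∃ δ : ℝ, 0 < δ ∧ δ < 1 ∧ ∀ᶠ x in 𝓝 x₀, 0 < F ((1 + δ) • x) ∧ F ((1 - δ) • x) < 0 ∧
      ∀ t ∈ Set.Icc (1 - δ) (1 + δ), t • x ∈ V := by
  have hd : HasDerivAt (fun t : ℝ => F ((1 + t) • x₀)) (fderiv ℝ F x₀ x₀) 0 := by
    have h1 : HasDerivAt (fun t : ℝ => (1 + t) • x₀) x₀ 0 := by
      simpa using ((hasDerivAt_id (0 : ℝ)).const_add 1).smul_const x₀
    have h2 : HasFDerivAt F (fderiv ℝ F x₀) ((1 + (0 : ℝ)) • x₀) := by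
      simpa using (hF.differentiableAt (by norm_num)).hasFDerivAt
    exact h2.comp_hasDerivAt 0 h1
  -- a box around `(1, x₀)` on which `t • x` stays in `V`
  have hbox : ∀ᶠ z : ℝ × E3 in 𝓝 (1, x₀), z.1 • z.2 ∈ V :=
    (continuous_smul.tendsto' (1, x₀) x₀ (by simp)).eventually (hV.mem_nhds hxV)
  rw [nhds_prod_eq] at hbox
  obtain ⟨pa, hpa, pb, hpb, hab⟩ := eventually_prod_iff.1 hbox
  obtain ⟨ε, hε, hεa⟩ := Metric.eventually_nhds_iff_ball.1 hpa
  have hslope := (hasDerivAt_iff_tendsto_slope.1 hd).eventually_const_lt hrad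
  rw [eventually_nhdsWithin_iff, Metric.eventually_nhds_iff_ball] at hslope
  obtain ⟨η, hη, hslope⟩ := hslope
  set δ := min (min ε η) 1 / 2 with hδ
  have hm : 0 < min (min ε η) 1 := by positivity
  have hδ0 : 0 < δ := by positivity
  have hδε : δ < ε := by
    have := (min_le_left (min ε η) 1).trans (min_le_left ε η)
    linarith
  have hδη : δ < η := by
    have := (min_le_left (min ε η) 1).trans (min_le_right ε η)
    linarith
  have hδ1 : δ < 1 := by
    have := min_le_right (min ε η) 1
    linarith
  have hδV : ∀ t ∈ Set.Icc (1 - δ) (1 + δ), pa t := by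
    intro t ht
    refine hεa t ?_
    rw [Metric.mem_ball, Real.dist_eq, abs_lt]
    constructor <;> linarith [ht.1, ht.2]
  have hpos : 0 < F ((1 + δ) • x₀) := by
    have h := hslope δ (by simp [abs_of_pos hδ0, hδη]) hδ0.ne'
    rw [slope_def_field] at h
    simp only [add_zero, one_smul, hF0, sub_zero] at h
    exact (div_pos_iff_of_pos_right hδ0).1 h
  have hneg : F ((1 - δ) • x₀) < 0 := by
    have h := hslope (-δ) (by simp [abs_of_pos hδ0, hδη]) (by simp [hδ0.ne'])
    rw [slope_def_field] at h
    simp only [add_zero, one_smul, hF0, sub_zero, ← sub_eq_add_neg] at h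
    by_contra hcon
    exact absurd h (not_lt.2 (div_nonpos_of_nonneg_of_nonpos (not_lt.1 hcon) (by linarith)))
  have hcont : ∀ t ∈ Set.Icc (1 - δ) (1 + δ), ContinuousAt (fun x => F (t • x)) x₀ := by
    intro t ht
    have : ContinuousAt F (t • x₀) :=
      hFV.continuousAt (hV.mem_nhds (hab (hδV t ht) hpb.self_of_nhds))
    exact this.comp (f := fun x : E3 => t • x) (by fun_prop)
  refine ⟨δ, hδ0, hδ1, ?_⟩
  filter_upwards [(hcont (1 + δ) ⟨by linarith, le_rfl⟩).eventually_const_lt hpos,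
    (hcont (1 - δ) ⟨le_rfl, by linarith⟩).eventually_lt_const hneg, hpb] with x h1 h2 h3
  exact ⟨h1, h2, fun t ht => hab (hδV t ht) h3⟩

/-- Under the hypotheses of `fderiv_eq_of_touching`, if `F` increases outwards then it is
non-negative outside the ball, near `x₀`. -/
lemma eventually_nonneg_of_touching {F : E3 → ℝ} {x₀ : E3} {V : Set E3} (hV : IsOpen V)
    (hxV : x₀ ∈ V) (hF : ContDiffOn ℝ 2 F V) (hF0 : F x₀ = 0) (hrad : 0 < fderiv ℝ F x₀ x₀)
    (hmax : ∀ x ∈ V, F x = 0 → ‖x‖ ≤ ‖x₀‖) :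
    ∀ᶠ x in 𝓝 x₀, ‖x₀‖ ≤ ‖x‖ → 0 ≤ F x := by
  obtain ⟨δ, hδ0, hδ1, hev⟩ := eventually_pos_neg_on_rays (hF.contDiffAt (hV.mem_nhds hxV)) hV hxV
    hF.continuousOn hF0 hrad
  have hx₀ : x₀ ≠ 0 := by rintro rfl; simp at hrad
  filter_upwards [hev] with x ⟨hpos, _, hxV'⟩ hn
  by_contra! hneg
  have hsub : Set.Icc 1 (1 + δ) ⊆ Set.Icc (1 - δ) (1 + δ) := Set.Icc_subset_Icc_left (by linarith)
  have hc : ContinuousOn (fun t : ℝ => F (t • x)) (Set.Icc 1 (1 + δ)) :=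
    hF.continuousOn.comp (by fun_prop) fun t ht => hxV' t (hsub ht)
  obtain ⟨t, ht, hFt⟩ := intermediate_value_Icc (by linarith) hc
    (show (0 : ℝ) ∈ Set.Icc _ _ from ⟨by simpa using hneg.le, hpos.le⟩)
  have ht1 : 1 < t := by
    refine lt_of_le_of_ne ht.1 ?_
    rintro rfl
    simp at hFt
    linarith
  have hle := hmax _ (hxV' t (hsub ht)) hFt
  have hxpos : 0 < ‖x‖ := (norm_pos_iff.2 hx₀).trans_le hn
  rw [norm_smul, Real.norm_of_nonneg (by linarith)] at hle
  nlinarith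

/-- A `C²` function on the line has non-negative second derivative at a local minimum. -/
lemma IsLocalMin.deriv_deriv_nonneg {φ φ' : ℝ → ℝ} {a φ'' : ℝ} (hmin : IsLocalMin φ a)
    (h1 : ∀ᶠ t in 𝓝 a, HasDerivAt φ (φ' t) t) (h2 : HasDerivAt φ' φ'' a) : 0 ≤ φ'' := by
  by_contra! hneg
  have hd : deriv φ =ᶠ[𝓝 a] φ' := h1.mono fun t ht => ht.deriv
  have hdd : deriv (deriv φ) a = φ'' := by rw [hd.deriv_eq, h2.deriv]
  have hmax := isLocalMax_of_deriv_deriv_neg (hdd ▸ hneg) hmin.deriv_eq_zero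
    h1.self_of_nhds.continuousAt
  have hconst : φ =ᶠ[𝓝 a] fun _ => φ a := by
    filter_upwards [hmin, hmax] with t ht ht' using le_antisymm ht' ht
  have h0 : deriv φ =ᶠ[𝓝 a] fun _ => 0 := by
    filter_upwards [hconst.eventuallyEq_nhds] with t ht
    rw [ht.deriv_eq]; simp
  rw [h0.deriv_eq] at hdd
  simp at hdd
  linarith

/-- Second order comparison at the touching point, along the curves
`x₀ + t v - (t²/2)(|v|²/|x₀|²) x₀`, which stay outside the ball. -/
lemma hessian_of_touching {F : E3 → ℝ} {x₀ : E3} {V : Set E3} {c : ℝ} (hV : IsOpen V)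
    (hxV : x₀ ∈ V) (hF : ContDiffOn ℝ 2 F V) (hF0 : F x₀ = 0) (hx₀ : x₀ ≠ 0) (hc : 0 < c)
    (hdF : fderiv ℝ F x₀ = c • innerSL ℝ x₀)
    (hmax : ∀ x ∈ V, F x = 0 → ‖x‖ ≤ ‖x₀‖) {v : E3} (hv : inner ℝ x₀ v = 0) :
    c * ‖v‖ ^ 2 ≤ fderiv ℝ (fderiv ℝ F) x₀ v v := by
  have hR : 0 < ‖x₀‖ := norm_pos_iff.2 hx₀
  have hnn := eventually_nonneg_of_touching hV hxV hF hF0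
    (by rw [hdF]; simp; positivity) hmax
  set q : ℝ := ‖v‖ ^ 2 / ‖x₀‖ ^ 2 with hq
  set γ : ℝ → E3 := fun t => x₀ + t • v - (t ^ 2 / 2 * q) • x₀ with hγ
  set γ' : ℝ → E3 := fun t => v - (t * q) • x₀ with hγ'
  have hγd : ∀ t, HasDerivAt γ (γ' t) t := by
    intro t
    have h := (((hasDerivAt_id t).smul_const v).const_add x₀).sub
      ((((hasDerivAt_pow 2 t).div_const 2).mul_const q).smul_const x₀)
    exact h.congr_deriv (by simp [hγ'])
  have hγd' : HasDerivAt γ' (-(q • x₀)) 0 := by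
    have h := (((hasDerivAt_id (0 : ℝ)).mul_const q).smul_const x₀).const_sub v
    exact h.congr_deriv (by simp)
  have hγ0 : γ 0 = x₀ := by simp [hγ]
  have hγ'0 : γ' 0 = v := by simp [hγ']
  have hγn : ∀ t, ‖x₀‖ ≤ ‖γ t‖ := by
    intro t
    refine le_of_sq_le_sq ?_ (norm_nonneg _)
    have h1 : ‖γ t‖ ^ 2 = (1 - t ^ 2 / 2 * q) ^ 2 * ‖x₀‖ ^ 2 + t ^ 2 * ‖v‖ ^ 2 := by
      have : γ t = (1 - t ^ 2 / 2 * q) • x₀ + t • v := by simp only [hγ]; module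
      rw [this, norm_add_sq_real, norm_smul, norm_smul, inner_smul_left, inner_smul_right, hv,
        mul_pow, mul_pow, Real.norm_eq_abs, Real.norm_eq_abs, sq_abs, sq_abs]
      simp
    have h2 : ‖v‖ ^ 2 = q * ‖x₀‖ ^ 2 := by rw [hq]; field_simp
    rw [h1, h2]
    nlinarith [sq_nonneg (t ^ 2 / 2 * q * ‖x₀‖)]
  have hγc : Tendsto γ (𝓝 0) (𝓝 x₀) := by
    simpa [hγ0] using (hγd 0).continuousAt.tendsto
  have hmin : IsLocalMin (fun t => F (γ t)) 0 := by
    filter_upwards [hγc.eventually hnn] with t ht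
    rw [hγ0, hF0]
    exact ht (hγn t)
  have hd1 : ∀ᶠ t in 𝓝 (0 : ℝ), HasDerivAt (fun t => F (γ t)) (fderiv ℝ F (γ t) (γ' t)) t := by
    filter_upwards [hγc.eventually (hV.mem_nhds hxV)] with t ht
    exact (((hF.contDiffAt (hV.mem_nhds ht)).differentiableAt
      (by norm_num)).hasFDerivAt).comp_hasDerivAt t (hγd t)
  have hFF : HasFDerivAt (fderiv ℝ F) (fderiv ℝ (fderiv ℝ F) x₀) (γ 0) := by
    rw [hγ0]
    exact (((hF.contDiffAt (hV.mem_nhds hxV)).fderiv_right (m := 1)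
      (by norm_num)).differentiableAt (by norm_num)).hasFDerivAt
  have hd2 := (hFF.comp_hasDerivAt 0 (hγd 0)).clm_apply hγd'
  have h := IsLocalMin.deriv_deriv_nonneg hmin hd1 hd2
  simp only [Function.comp_apply, hγ'0, hγ0, hdF] at h
  simp [inner_smul_right] at h
  have h2 : ‖v‖ ^ 2 = q * ‖x₀‖ ^ 2 := by rw [hq]; field_simp
  rw [h2]
  linarith

/-! ### Outermost minimal spheres -/

lemma eq_sum_single (x : E3) : x = ∑ i, x i • EuclideanSpace.single i (1 : ℝ) := by
  ext j
  fin_cases j <;> simp [Fin.sum_univ_three]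

lemma pd_pd {F : E3 → ℝ} {x : E3} (hF : ContDiffAt ℝ 2 F x) (i j : Fin 3) :
    pd i (pd j F) x =
      fderiv ℝ (fderiv ℝ F) x (EuclideanSpace.single i 1) (EuclideanSpace.single j 1) := by
  have h : HasFDerivAt (fderiv ℝ F) (fderiv ℝ (fderiv ℝ F) x) x :=
    ((hF.fderiv_right (m := 1) (by norm_num)).differentiableAt (by norm_num)).hasFDerivAt
  have h2 := h.clm_apply (hasFDerivAt_const (EuclideanSpace.single j (1 : ℝ)) x)
  exact (HasFDerivAt.pd h2 i).trans (by simp)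

lemma sum_pd_pd {F : E3 → ℝ} {x : E3} (hF : ContDiffAt ℝ 2 F x) :
    ∑ i, ∑ j, x i * x j * pd i (pd j F) x = fderiv ℝ (fderiv ℝ F) x x x := by
  set Q := fderiv ℝ (fderiv ℝ F) x
  simp only [pd_pd hF]
  conv_rhs => rw [eq_sum_single x]
  simp only [map_sum, map_smul, sum_apply, smul_apply, smul_eq_mul,
    Finset.mul_sum]
  rw [Finset.sum_comm]
  refine Finset.sum_congr rfl fun i _ => Finset.sum_congr rfl fun j _ => ?_
  ring

/-- The trace of a bilinear form over the orthogonal complement of `x`, computed by projecting the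
standard basis. -/
lemma two_mul_le_trace {Q : E3 →L[ℝ] E3 →L[ℝ] ℝ} {x : E3} {c : ℝ} (hx : x ≠ 0)
    (h : ∀ v, inner ℝ x v = 0 → c * ‖v‖ ^ 2 ≤ Q v v) :
    2 * c ≤ ∑ i, Q (EuclideanSpace.single i 1) (EuclideanSpace.single i 1)
      - (‖x‖ ^ 2)⁻¹ * Q x x := by
  set e : Fin 3 → E3 := fun i => EuclideanSpace.single i 1 with he
  have hR : ‖x‖ ^ 2 ≠ 0 := by simp [hx]
  set s : ℝ := (‖x‖ ^ 2)⁻¹ with hs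
  have hsR : s * ‖x‖ ^ 2 = 1 := inv_mul_cancel₀ hR
  have hxe : ∀ i, inner ℝ x (e i) = x i := fun i => by
    simp [he, EuclideanSpace.inner_single_right]
  have hort : ∀ i, inner ℝ x (e i - (s * x i) • x) = 0 := by
    intro i
    rw [inner_sub_right, inner_smul_right, hxe, real_inner_self_eq_norm_sq]
    linear_combination -x i * hsR
  have hnorm : ∀ i, ‖e i - (s * x i) • x‖ ^ 2 = 1 - s * x i ^ 2 := by
    intro i
    rw [norm_sub_sq_real, inner_smul_right, real_inner_comm, hxe, norm_smul, mul_pow,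
      Real.norm_eq_abs, sq_abs]
    have : ‖e i‖ = 1 := by simp [he]
    rw [this]
    linear_combination s * x i ^ 2 * hsR
  have hsum := Finset.sum_le_sum fun i (_ : i ∈ Finset.univ) => h _ (hort i)
  simp only [hnorm] at hsum
  have hl : ∑ i, c * (1 - s * x i ^ 2) = 2 * c := by
    have : ∑ i, x i ^ 2 = ‖x‖ ^ 2 := (norm_sq_eq_sum x).symm
    simp only [Fin.sum_univ_three] at this ⊢
    linear_combination -c * s * this - c * hsR
  have hlin : ∀ L : E3 →L[ℝ] ℝ, ∑ i, x i * L (e i) = L x := fun L => by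
    conv_rhs => rw [eq_sum_single x]
    simp [he]
  have hQ1 : ∑ i, x i * Q (e i) x = Q x x := by simpa using hlin (Q.flip x)
  have hQ2 := hlin (Q x)
  have hx2 : ∑ i, x i ^ 2 = ‖x‖ ^ 2 := (norm_sq_eq_sum x).symm
  rw [hl] at hsum
  refine hsum.trans_eq ?_
  simp only [map_sub, map_smul, sub_apply, smul_apply, smul_eq_mul, Fin.sum_univ_three]
    at hQ1 hQ2 hx2 ⊢
  linear_combination -s * hQ1 - s * hQ2 + s ^ 2 * Q x x * hx2 + s * Q x x * hsR

/-- A minimal surface of `w δ` cannot touch from the inside a sphere whose mean curvature is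
positive. The mean curvature of the sphere through `x₀` has the sign of `2 w + r ∂_r w`. -/
lemma levelMeanCurvature_ne_zero_of_touching {w F : E3 → ℝ} {x₀ : E3} {V : Set E3}
    (hw : DifferentiableAt ℝ w x₀) (hwpos : 0 < w x₀) (hmc : 0 < 2 * w x₀ + ∑ i, x₀ i * pd i w x₀)
    (hV : IsOpen V) (hxV : x₀ ∈ V) (hF : ContDiffOn ℝ 2 F V) (hF0 : F x₀ = 0)
    (hdF : fderiv ℝ F x₀ ≠ 0) (hx₀ : x₀ ≠ 0) (hmax : ∀ x ∈ V, F x = 0 → ‖x‖ ≤ ‖x₀‖) :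
    levelMeanCurvature (conformalMetric w) F x₀ ≠ 0 := by
  have hFx := hF.contDiffAt (hV.mem_nhds hxV)
  obtain ⟨c, hc, hdc⟩ := fderiv_eq_of_touching (hV.mem_nhds hxV) hFx hF0 hdF hx₀ hmax
  have hgrad : ∀ i, pd i F x₀ = c * x₀ i := fun i => by
    simp [pd, hdc, EuclideanSpace.inner_single_right]
  set T : ℝ := ∑ i, pd i (pd i F) x₀ - (‖x₀‖ ^ 2)⁻¹ * ∑ i, ∑ j, x₀ i * x₀ j * pd i (pd j F) x₀
    with hT
  have hTQ : T = ∑ i, fderiv ℝ (fderiv ℝ F) x₀ (EuclideanSpace.single i 1)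
      (EuclideanSpace.single i 1) - (‖x₀‖ ^ 2)⁻¹ * fderiv ℝ (fderiv ℝ F) x₀ x₀ x₀ := by
    rw [hT, sum_pd_pd hFx]
    simp only [pd_pd hFx]
  have hcT : 2 * c ^ 2 ≤ c * T := by
    rcases lt_or_gt_of_ne hc with hneg | hpos
    · have hd : fderiv ℝ (fun x => -F x) = fun x => -fderiv ℝ F x := by
        ext1 x; exact fderiv_fun_neg
      have h := two_mul_le_trace (Q := -fderiv ℝ (fderiv ℝ F) x₀) hx₀ fun v hv => by
        have := hessian_of_touching (F := fun x => -F x) (c := -c) hV hxV hF.neg (by simp [hF0]) hx₀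
          (by linarith) (by rw [hd]; simp [hdc]) (by simpa using hmax) hv
        rw [hd, fderiv_fun_neg] at this
        exact this
      simp only [neg_apply, Finset.sum_neg_distrib, mul_neg] at h
      nlinarith
    · have h := two_mul_le_trace hx₀ fun v hv =>
        hessian_of_touching hV hxV hF hF0 hx₀ hpos hdc hmax hv
      rw [← hTQ] at h
      nlinarith
  rw [levelMeanCurvature_conformal hw hwpos hFx hc hx₀ hgrad, ← hT]
  refine mul_ne_zero (by positivity) (mul_ne_zero (by positivity) fun h0 => ?_)
  have h1 : c * (c * ∑ i, x₀ i * pd i w x₀ + w x₀ * T) = 0 := by rw [h0, mul_zero]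
  have h2 : 0 < c ^ 2 * (2 * w x₀ + ∑ i, x₀ i * pd i w x₀) := by positivity
  nlinarith [mul_le_mul_of_nonneg_left hcT hwpos.le]

/-- The sphere `∂M` is minimal for `w δ` as soon as `2 w + r ∂_r w` vanishes on it. -/
lemma isMinimalSurface_horizon {w : E3 → ℝ} {m₁ : ℝ} (hm : 0 < m₁)
    (hw : ∀ x ∈ horizon m₁, DifferentiableAt ℝ w x ∧ 0 < w x)
    (h0 : ∀ x ∈ horizon m₁, 2 * w x + ∑ i, x i * pd i w x = 0) :
    IsMinimalSurface (conformalMetric w) (Subtype.val : horizon m₁ → E3) := by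
  intro p
  have hF : ContDiff ℝ 2 fun x : E3 => ‖x‖ ^ 2 - (m₁ / 2) ^ 2 :=
    (contDiff_norm_sq ℝ).sub contDiff_const
  have hfd : ∀ x : E3, HasFDerivAt (fun x : E3 => ‖x‖ ^ 2 - (m₁ / 2) ^ 2) (2 • innerSL ℝ x) x :=
    fun x => ((hasStrictFDerivAt_norm_sq x).hasFDerivAt).sub_const _
  have hpd : ∀ i, pd i (fun x : E3 => ‖x‖ ^ 2 - (m₁ / 2) ^ 2) = fun x => 2 * x i := by
    intro i
    ext x
    rw [HasFDerivAt.pd (hfd x)]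
    simp [EuclideanSpace.inner_single_right]
  have hnorm : ∀ x ∈ horizon m₁, ‖x‖ = m₁ / 2 := fun x hx => by simpa [horizon] using hx
  have hne : ∀ x ∈ horizon m₁, x ≠ 0 := by
    rintro x hx rfl
    have := hnorm _ hx
    simp at this
    linarith
  refine ⟨Set.univ, {0}ᶜ, fun x => ‖x‖ ^ 2 - (m₁ / 2) ^ 2, isOpen_univ, Set.mem_univ _,
    isOpen_compl_singleton, hF.contDiffOn, ?_, ?_, ?_, ?_⟩
  · intro x hx h
    rw [(hfd x).fderiv] at h
    have := congrArg (fun L => L x) h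
    simp at this
    exact hx this
  · exact Topology.IsEmbedding.subtypeVal.comp Topology.IsEmbedding.subtypeVal
  · ext x
    simp only [Set.image_univ, Subtype.range_coe_subtype, Set.mem_ofPred_eq, Set.mem_compl_iff,
      Set.mem_singleton_iff]
    constructor
    · intro hx
      exact ⟨hne x hx, by rw [hnorm x hx]; ring⟩
    · rintro ⟨_, hx⟩
      have : ‖x‖ = m₁ / 2 := by
        rw [← sq_eq_sq₀ (norm_nonneg _) (by positivity)]; linarith
      simpa [horizon] using this
  · rintro x ⟨y, _, rfl⟩
    have hy := y.2
    have hR : ‖(y : E3)‖ ^ 2 ≠ 0 := by simp [hne _ hy]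
    rw [levelMeanCurvature_conformal (c := 2) (hw _ hy).1 (hw _ hy).2 hF.contDiffAt two_ne_zero
      (hne _ hy) fun i => by rw [hpd]]
    have hpd2 : ∀ i j, pd i (pd j fun x : E3 => ‖x‖ ^ 2 - (m₁ / 2) ^ 2) y
        = if i = j then 2 else 0 := by
      intro i j
      rw [hpd, pd_const_mul 2 (differentiableAt_coord j _), pd_coord]
      simp
    have hs : ∑ i, ∑ j, (y : E3) i * (y : E3) j * (if i = j then 2 else 0 : ℝ)
        = 2 * ‖(y : E3)‖ ^ 2 := by
      rw [norm_sq_eq_sum]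
      simp [Fin.sum_univ_three]
      ring
    simp only [hpd2]
    rw [hs]
    have h := h0 _ hy
    refine mul_eq_zero_of_right _ (mul_eq_zero_of_right _ ?_)
    have h3 : (‖(y : E3)‖ ^ 2)⁻¹ * (2 * ‖(y : E3)‖ ^ 2) = 2 := by
      rw [mul_comm 2, inv_mul_cancel_left₀ hR]
    rw [h3]
    simp
    linarith

/-- A non-empty compact immersed surface contained in a sphere `∂M` is all of it: its image is
closed, and it is open because a surface inside the sphere is cut by every nearby ray. -/
lemma range_eq_horizon {g : E3 → Mat3} {m₁ : ℝ} (hm : 0 < m₁) {N : Type} [TopologicalSpace N]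
    [CompactSpace N] [Nonempty N] {f : N → E3} (hf : IsMinimalSurface g f) (hfc : Continuous f)
    (hsub : Set.range f ⊆ horizon m₁) : Set.range f = horizon m₁ := by
  refine hsub.antisymm ?_
  have hnorm : ∀ x, x ∈ horizon m₁ ↔ ‖x‖ = m₁ / 2 := fun x => by simp [horizon]
  have hclosed : IsClosed (Set.range f) := (isCompact_range hfc).isClosed
  have hopen : ∀ x ∈ Set.range f, ∀ᶠ y in 𝓝 x, y ∈ horizon m₁ → y ∈ Set.range f := by
    rintro _ ⟨p, rfl⟩
    obtain ⟨W, V, F, hW, hpW, hV, hF, hdF, -, himg, -⟩ := hf p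
    have hpV : f p ∈ V ∧ F (f p) = 0 := by
      have := Set.mem_image_of_mem f hpW
      rwa [himg] at this
    have hzero : ∀ x ∈ V, F x = 0 → x ∈ Set.range f := fun x hx hx0 => by
      have : x ∈ f '' W := himg ▸ (⟨hx, hx0⟩ : x ∈ {x | x ∈ V ∧ F x = 0})
      exact Set.image_subset_range _ _ this
    have hpn : ‖f p‖ = m₁ / 2 := (hnorm _).1 (hsub ⟨p, rfl⟩)
    have hp0 : f p ≠ 0 := by rw [← norm_pos_iff, hpn]; positivity
    have hFp := hF.contDiffAt (hV.mem_nhds hpV.1)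
    obtain ⟨c, hc, hdc⟩ := fderiv_eq_of_touching (hV.mem_nhds hpV.1) hFp hpV.2 (hdF _ hpV.1) hp0
      fun x hx hx0 => ((hnorm _).1 (hsub (hzero x hx hx0))).trans hpn.symm |>.le
    -- it suffices to treat an `F` that increases outwards
    have key : ∀ G : E3 → ℝ, ContDiffOn ℝ 2 G V → (∀ x, G x = 0 → F x = 0) → G (f p) = 0 →
        0 < fderiv ℝ G (f p) (f p) → ∀ᶠ y in 𝓝 (f p), y ∈ horizon m₁ → y ∈ Set.range f := by
      intro G hG hGF hG0 hrad
      obtain ⟨δ, hδ0, hδ1, hev⟩ := eventually_pos_neg_on_rays (hG.contDiffAt (hV.mem_nhds hpV.1))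
        hV hpV.1 hG.continuousOn hG0 hrad
      filter_upwards [hev] with y ⟨hpos, hneg, hyV⟩ hy
      have hcont : ContinuousOn (fun t : ℝ => G (t • y)) (Set.Icc (1 - δ) (1 + δ)) :=
        hG.continuousOn.comp (by fun_prop) fun t ht => hyV t ht
      obtain ⟨t, ht, hGt⟩ := intermediate_value_Icc (by linarith) hcont
        (show (0 : ℝ) ∈ Set.Icc _ _ from ⟨hneg.le, hpos.le⟩)
      have hmem := hzero _ (hyV t ht) (hGF _ hGt)
      have htn := (hnorm _).1 (hsub hmem)
      have ht0 : 0 < t := by linarith [ht.1]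
      rw [norm_smul, (hnorm _).1 hy, Real.norm_of_nonneg ht0.le] at htn
      have ht1 : t = 1 := by
        have : (t - 1) * (m₁ / 2) = 0 := by linarith
        rcases mul_eq_zero.1 this with h | h <;> linarith
      simpa [ht1] using hmem
    have hrad : fderiv ℝ F (f p) (f p) = c * ‖f p‖ ^ 2 := by rw [hdc]; simp
    have hR : 0 < ‖f p‖ ^ 2 := by positivity
    rcases lt_or_gt_of_ne hc with hneg | hpos
    · refine key (fun x => -F x) hF.neg (by simp) (by simp [hpV.2]) ?_
      rw [fderiv_fun_neg, neg_apply, hrad]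
      nlinarith
    · exact key F hF (fun _ h => h) hpV.2 (by rw [hrad]; positivity)
  have hrank : 1 < Module.rank ℝ E3 := by
    rw [rank_eq_card_basis (EuclideanSpace.basisFun (Fin 3) ℝ).toBasis]
    simp
  have hpre : IsPreconnected (horizon m₁) := isPreconnected_sphere hrank 0 _
  obtain ⟨U, hUo, hU⟩ : ∃ U : Set E3, IsOpen U ∧ U ∩ horizon m₁ = Set.range f := by
    refine ⟨interior {y | y ∈ horizon m₁ → y ∈ Set.range f}, isOpen_interior, ?_⟩
    ext x
    constructor
    · rintro ⟨h1, h2⟩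
      exact interior_subset h1 h2
    · intro hx
      exact ⟨mem_interior_iff_mem_nhds.2 (hopen x hx), hsub hx⟩
  have hne : (horizon m₁ ∩ U).Nonempty := by
    rw [Set.inter_comm, hU]
    exact Set.range_nonempty f
  intro x hx
  by_contra hxf
  obtain ⟨y, hy, hyU, hyf⟩ := hpre U (Set.range f)ᶜ hUo hclosed.isOpen_compl
    (fun y hy => (em (y ∈ Set.range f)).imp (fun h => (hU ▸ h : y ∈ U ∩ horizon m₁).1) id)
    hne ⟨x, hx, hxf⟩
  exact hyf (hU ▸ ⟨hyU, hy⟩)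

/-- If the spheres `|x| = r` of `w δ` are minimal for `r = m₁/2` and have positive mean curvature
for `r > m₁/2`, then `∂M` is outermost minimal: a compact minimal surface touches from the inside
the sphere through its farthest point. -/
theorem hasOutermostMinimalBoundary_conformal {w : E3 → ℝ} {m₁ : ℝ} (hm : 0 < m₁)
    (hw : ∀ x ∈ exterior m₁, DifferentiableAt ℝ w x ∧ 0 < w x)
    (h0 : ∀ x ∈ horizon m₁, 2 * w x + ∑ i, x i * pd i w x = 0)
    (hpos : ∀ x : E3, m₁ / 2 < ‖x‖ → 0 < 2 * w x + ∑ i, x i * pd i w x) :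
    HasOutermostMinimalBoundary m₁ (conformalMetric w) := by
  refine ⟨isMinimalSurface_horizon hm (fun x hx => hw x ?_) h0, ?_⟩
  · have : ‖x‖ = m₁ / 2 := by simpa [horizon] using hx
    exact this.ge
  intro N _ _ _ _ f hf hsub
  have hfc : Continuous f := by
    refine continuous_iff_continuousAt.2 fun p => ?_
    obtain ⟨W, V, F, hW, hpW, hV, hF, hdF, hemb, -, -⟩ := hf p
    exact (continuousOn_iff_continuous_domRestrict.2 hemb.continuous).continuousAt (hW.mem_nhds hpW)
  refine range_eq_horizon hm hf hfc ?_
  obtain ⟨p, -, hp⟩ := isCompact_univ.exists_isMaxOn Set.univ_nonempty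
    (continuous_norm.comp hfc).continuousOn
  have hple : ∀ q, ‖f q‖ ≤ ‖f p‖ := fun q => hp (Set.mem_univ q)
  have hpm : m₁ / 2 ≤ ‖f p‖ := hsub ⟨p, rfl⟩
  rcases hpm.lt_or_eq with hlt | heq
  · exfalso
    obtain ⟨W, V, F, hW, hpW, hV, hF, hdF, -, himg, hmin⟩ := hf p
    have hpV : f p ∈ V ∧ F (f p) = 0 := by
      have := Set.mem_image_of_mem f hpW
      rwa [himg] at this
    have hp0 : f p ≠ 0 := by rw [← norm_pos_iff]; linarith
    refine levelMeanCurvature_ne_zero_of_touching (hw _ hpm).1 (hw _ hpm).2 (hpos _ hlt) hV hpV.1 hF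
      hpV.2 (hdF _ hpV.1) hp0 (fun x hx hx0 => ?_) (hmin _ (Set.mem_image_of_mem f hpW))
    have : x ∈ f '' W := himg ▸ (⟨hx, hx0⟩ : x ∈ {x | x ∈ V ∧ F x = 0})
    obtain ⟨q, -, rfl⟩ := this
    exact hple q
  · rintro _ ⟨q, rfl⟩
    have h1 : m₁ / 2 ≤ ‖f q‖ := hsub ⟨q, rfl⟩
    have h2 := hple q
    simp only [horizon, mem_sphere_iff_norm, sub_zero]
    linarith

/-! ### The example: geometry and admissibility -/

/-- The function `u(r) = 1 + (6k + m₁²)/(2 m₁ r) - k/(2r²)`; the metric of the example is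
`u⁴ δ`. -/
noncomputable def profile (m₁ k r : ℝ) : ℝ :=
  1 + (6 * k + m₁ ^ 2) / (2 * m₁ * r) - k / (2 * r ^ 2)

lemma UEx_eq (m₁ k : ℝ) : UEx m₁ k = fun x => -2 * Real.log (profile m₁ k ‖x‖) := rfl

lemma metric_dataEx (m₁ k : ℝ) :
    (dataEx m₁ k).metric = conformalMetric fun x => Real.exp (-2 * UEx m₁ k x) := by
  ext x i j
  simp only [AxiData.metric, dataEx, conformalMetric, Matrix.of_apply, Matrix.smul_apply,
    smul_eq_mul]
  fin_cases i <;> fin_cases j <;> simp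

lemma one_lt_profile {m₁ k r : ℝ} (hm : 0 < m₁) (hk : 0 < k) (hr : m₁ / 4 < r) :
    1 < profile m₁ k r := by
  have hr0 : 0 < r := by linarith
  have h : profile m₁ k r - 1 = ((6 * k + m₁ ^ 2) * r - m₁ * k) / (2 * m₁ * r ^ 2) := by
    rw [profile]; field_simp; ring
  have h2 : 0 < (6 * k + m₁ ^ 2) * r - m₁ * k := by nlinarith [mul_pos hk hm, mul_pos hk hr0]
  have h3 : 0 < profile m₁ k r - 1 := by rw [h]; positivity
  linarith

lemma hasDerivAt_profile {m₁ k r : ℝ} (hm : 0 < m₁) (hr : 0 < r) :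
    HasDerivAt (profile m₁ k) (-(6 * k + m₁ ^ 2) / (2 * m₁ * r ^ 2) + k / r ^ 3) r := by
  have h1 := (((hasDerivAt_id r).const_mul (2 * m₁)).inv (by simpa using ⟨hm.ne', hr.ne'⟩)).const_mul
    (6 * k + m₁ ^ 2)
  have h2 := (((hasDerivAt_pow 2 r).const_mul 2).inv (by positivity)).const_mul k
  refine ((h1.const_add 1).sub h2).congr_deriv ?_
  simp
  field_simp
  ring

/-- On the spheres `|x| = r` the mean curvature of `u⁴ δ` has the sign of `u + 2 r u'`. -/
lemma profile_add_deriv {m₁ k r : ℝ} (hm : 0 < m₁) (hr : 0 < r) :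
    profile m₁ k r + 2 * r * (-(6 * k + m₁ ^ 2) / (2 * m₁ * r ^ 2) + k / r ^ 3) =
      (1 - m₁ / (2 * r)) * (1 - 3 * k / (m₁ * r)) := by
  rw [profile]; field_simp; ring

lemma contDiffAt_profile_norm {m₁ k : ℝ} (hm : 0 < m₁) {x : E3} (hx : x ≠ 0) (n : WithTop ℕ∞) :
    ContDiffAt ℝ n (fun y : E3 => profile m₁ k ‖y‖) x := by
  have h : 0 < ‖x‖ := norm_pos_iff.2 hx
  have hn : ContDiffAt ℝ n (fun y : E3 => ‖y‖) x := contDiffAt_norm ℝ hx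
  unfold profile
  refine (contDiffAt_const.add (contDiffAt_const.div (contDiffAt_const.mul hn) ?_)).sub
    (contDiffAt_const.div (contDiffAt_const.mul (hn.pow 2)) ?_) <;> positivity

lemma laplacian_profile {m₁ k : ℝ} (hm : 0 < m₁) {x : E3} (hx : x ≠ 0) :
    ∑ i, pd i (pd i fun y => profile m₁ k ‖y‖) x = -k / ‖x‖ ^ 4 := by
  have hr : 0 < ‖x‖ := norm_pos_iff.2 hx
  set ψ : ℝ → ℝ := fun r => -(6 * k + m₁ ^ 2) / (2 * m₁ * r ^ 3) + k / r ^ 4 with hψ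
  have h1 : ∀ i, pd i (fun y => profile m₁ k ‖y‖) =ᶠ[𝓝 x] fun y => ψ ‖y‖ * y i := by
    intro i
    filter_upwards [isOpen_ne.mem_nhds hx] with y hy
    have hy0 : 0 < ‖y‖ := norm_pos_iff.2 hy
    rw [pd_radial hy (hasDerivAt_profile hm hy0)]
    simp only [hψ]
    field_simp
  have hψd : HasDerivAt ψ (3 * (6 * k + m₁ ^ 2) / (2 * m₁ * ‖x‖ ^ 4) - 4 * k / ‖x‖ ^ 5) ‖x‖ := by
    have h1 := (((hasDerivAt_pow 3 ‖x‖).const_mul (2 * m₁)).inv (by positivity)).const_mul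
      (-(6 * k + m₁ ^ 2))
    have h2 := ((hasDerivAt_pow 4 ‖x‖).inv (by positivity)).const_mul k
    refine (h1.add h2).congr_deriv ?_
    simp
    field_simp
    ring
  have hψx : DifferentiableAt ℝ (fun y : E3 => ψ ‖y‖) x :=
    (hψd.comp_hasFDerivAt x (hasFDerivAt_norm hx)).differentiableAt
  have h2 : ∀ i, pd i (pd i fun y => profile m₁ k ‖y‖) x = ψ ‖x‖ + x i ^ 2 *
      ((3 * (6 * k + m₁ ^ 2) / (2 * m₁ * ‖x‖ ^ 4) - 4 * k / ‖x‖ ^ 5) / ‖x‖) := by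
    intro i
    rw [pd_congr (h1 i), pd_mul hψx (differentiableAt_coord i x), pd_coord, pd_radial hx hψd]
    simp
    ring
  simp only [h2, Finset.sum_add_distrib, ← Finset.sum_mul]
  rw [← norm_sq_eq_sum]
  simp [hψ]
  field_simp
  ring

lemma ne_zero_of_lt_norm {a : ℝ} (ha : 0 < a) {x : E3} (hx : a < ‖x‖) : x ≠ 0 :=
  norm_pos_iff.1 (ha.trans hx)

lemma quarter_lt_norm {m₁ : ℝ} (hm : 0 < m₁) {x : E3} (hx : x ∈ exterior m₁) : m₁ / 4 < ‖x‖ := by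
  have : m₁ / 2 ≤ ‖x‖ := hx
  linarith

lemma contDiffAt_UEx {m₁ k : ℝ} (hm : 0 < m₁) (hk : 0 < k) {x : E3} (hx : m₁ / 4 < ‖x‖)
    (n : WithTop ℕ∞) : ContDiffAt ℝ n (UEx m₁ k) x := by
  have h := one_lt_profile hm hk hx
  exact contDiffAt_const.mul
    ((contDiffAt_profile_norm hm (ne_zero_of_lt_norm (by positivity) hx) n).log (by positivity))

lemma scalarCurvature_dataEx {m₁ k : ℝ} (hm : 0 < m₁) (hk : 0 < k) {x : E3}
    (hx : x ∈ exterior m₁) : 0 < scalarCurvature (dataEx m₁ k).metric x := by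
  have hx4 := quarter_lt_norm hm hx
  have hx0 : x ≠ 0 := ne_zero_of_lt_norm (by positivity) hx4
  have hu := one_lt_profile hm hk hx4
  rw [metric_dataEx, UEx_eq]
  rw [scalarCurvature_log (contDiffAt_profile_norm hm hx0 2) (by linarith),
    laplacian_profile hm hx0]
  have h1 : 0 < profile m₁ k ‖x‖ := by linarith
  have h2 : -8 / profile m₁ k ‖x‖ ^ 5 * (-k / ‖x‖ ^ 4) =
      8 / profile m₁ k ‖x‖ ^ 5 * (k / ‖x‖ ^ 4) := by ring
  rw [h2]
  positivity

lemma hasDerivAt_log_profile {m₁ k r : ℝ} (hm : 0 < m₁) (hk : 0 < k) (hr : m₁ / 4 < r) :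
    HasDerivAt (fun r => -2 * Real.log (profile m₁ k r))
      (-2 * ((-(6 * k + m₁ ^ 2) / (2 * m₁ * r ^ 2) + k / r ^ 3) / profile m₁ k r)) r := by
  have h := one_lt_profile hm hk hr
  exact ((hasDerivAt_profile hm (by linarith)).log (by positivity)).const_mul (-2)

lemma mean_curvature_dataEx {m₁ k : ℝ} (hm : 0 < m₁) (hk : 0 < k) {x : E3} (hx : m₁ / 4 < ‖x‖) :
    2 * Real.exp (-2 * UEx m₁ k x) + ∑ i, x i * pd i (fun y => Real.exp (-2 * UEx m₁ k y)) x =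
      2 * Real.exp (-2 * UEx m₁ k x) / profile m₁ k ‖x‖ *
        ((1 - m₁ / (2 * ‖x‖)) * (1 - 3 * k / (m₁ * ‖x‖))) := by
  have hx0 : x ≠ 0 := ne_zero_of_lt_norm (by positivity) hx
  have hr : 0 < ‖x‖ := norm_pos_iff.2 hx0
  have hu : 0 < profile m₁ k ‖x‖ := zero_lt_one.trans (one_lt_profile hm hk hx)
  have hd := ((hasDerivAt_log_profile hm hk hx).const_mul (-2)).exp
  have hpd := fun i => pd_radial (φ := fun r => Real.exp (-2 * (-2 * Real.log (profile m₁ k r))))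
    hx0 hd i
  simp only [UEx_eq]
  simp only [hpd]
  rw [← profile_add_deriv hm hr]
  generalize -(6 * k + m₁ ^ 2) / (2 * m₁ * ‖x‖ ^ 2) + k / ‖x‖ ^ 3 = u'
  generalize Real.exp (-2 * (-2 * Real.log (profile m₁ k ‖x‖))) = w
  generalize profile m₁ k ‖x‖ = u at hu
  have hs : ∑ i, x i * (w * (-2 * (-2 * (u' / u))) * (x i / ‖x‖)) = 4 * w * u' / u * ‖x‖ := by
    have h2 : ∑ i, x i * (w * (-2 * (-2 * (u' / u))) * (x i / ‖x‖)) =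
        (4 * w * u' / u) / ‖x‖ * ∑ i, x i ^ 2 := by
      rw [Finset.mul_sum]
      exact Finset.sum_congr rfl fun i _ => by ring
    rw [h2, ← norm_sq_eq_sum]
    field_simp
  rw [hs]
  field_simp
  ring

lemma outermost_dataEx {m₁ k : ℝ} (hm : 0 < m₁) (hk : 0 < k) (hk' : k < m₁ ^ 2 / 6) :
    HasOutermostMinimalBoundary m₁ (dataEx m₁ k).metric := by
  rw [metric_dataEx]
  refine hasOutermostMinimalBoundary_conformal hm (fun x hx => ⟨?_, Real.exp_pos _⟩) ?_ ?_
  · exact (contDiffAt_const.mul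
      (contDiffAt_UEx hm hk (quarter_lt_norm hm hx) 1)).exp.differentiableAt (by norm_num)
  · intro x hx
    have hxn : ‖x‖ = m₁ / 2 := by simpa [horizon] using hx
    rw [mean_curvature_dataEx hm hk (by rw [hxn]; linarith), hxn]
    have : 1 - m₁ / (2 * (m₁ / 2)) = 0 := by field_simp; norm_num
    rw [this]
    ring
  · intro x hx
    have hr : 0 < ‖x‖ := by linarith
    have hx4 : m₁ / 4 < ‖x‖ := by linarith
    rw [mean_curvature_dataEx hm hk hx4]
    have hu : 0 < profile m₁ k ‖x‖ := zero_lt_one.trans (one_lt_profile hm hk hx4)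
    have h1 : 0 < 1 - m₁ / (2 * ‖x‖) := by
      rw [sub_pos, div_lt_one (by positivity)]; linarith
    have h2 : 0 < 1 - 3 * k / (m₁ * ‖x‖) := by
      rw [sub_pos, div_lt_one (by positivity)]; nlinarith
    positivity

lemma profile_eq_inv (m₁ k r : ℝ) :
    profile m₁ k r = 1 + (6 * k + m₁ ^ 2) / (2 * m₁) * r⁻¹ - k / 2 * r⁻¹ ^ 2 := by
  rw [profile]; ring

lemma admissible_dataEx {m₁ k : ℝ} (hm : 0 < m₁) (hk : 0 < k) (hk' : k < m₁ ^ 2 / 6) :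
    Admissible m₁ (dataEx m₁ k) := by
  set q : ℝ → ℝ := fun t =>
    -2 * Real.log (1 + (6 * k + m₁ ^ 2) / (2 * m₁) * t - k / 2 * t ^ 2) with hq
  have hUq : UEx m₁ k = fun x => q ‖x‖⁻¹ := by
    ext x
    simp only [UEx_eq, hq, profile_eq_inv]
  have hqa : AnalyticAt ℝ q 0 := by
    have h : AnalyticAt ℝ (fun t : ℝ => 1 + (6 * k + m₁ ^ 2) / (2 * m₁) * t - k / 2 * t ^ 2) 0 := by
      fun_prop
    exact analyticAt_const.mul (h.log (by simp))
  have hq0 : q 0 = 0 := by simp [hq]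
  set p : ℝ → ℝ := fun t => Real.exp (-2 * q t) - 1 with hp
  have hpa : AnalyticAt ℝ p 0 := ((analyticAt_const.mul hqa).rexp').sub analyticAt_const
  have hp0 : p 0 = 0 := by simp [hp, hq0]
  have hmet : ∀ i j x, (dataEx m₁ k).metric x i j - (1 : Mat3) i j
      = if i = j then p ‖x‖⁻¹ else 0 := by
    intro i j x
    rw [metric_dataEx]
    by_cases h : i = j <;> simp [conformalMetric, Matrix.one_apply, h, hp, hUq]
  have haxi : ∀ c : ℝ, IsSmoothAxisymmetricOn (fun _ => c) {x | m₁ / 4 < ‖x‖} := fun c =>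
    ⟨contDiffOn_const, fun _ _ _ _ _ _ => rfl⟩
  refine ⟨⟨m₁ / 4, by positivity, by linarith, ⟨?_, ?_⟩, haxi 0, haxi 0, haxi 0,
    fun _ _ _ _ => rfl⟩,
    ⟨5, le_rfl, ?_, ?_, isLittleOk_zero _ _, isLittleOk_zero _ _, isLittleOk_zero _ _⟩, ?_,
    fun x hx => (scalarCurvature_dataEx hm hk hx).le, outermost_dataEx hm hk hk'⟩
  · intro x hx
    exact (contDiffAt_UEx hm hk hx _).contDiffWithinAt
  · intro x _ y _ hxy hz
    have : ‖x‖ = ‖y‖ := by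
      rw [← sq_eq_sq₀ (norm_nonneg _) (norm_nonneg _), norm_sq_eq_sum, norm_sq_eq_sum]
      simp only [Fin.sum_univ_three, hxy, hz]
    simp only [dataEx, UEx_eq, this]
  · intro i j
    simp only [hmet]
    split_ifs
    · exact isLittleOk_radial hpa hp0 5
    · exact isLittleOk_zero _ _
  · have := isLittleOk_radial hqa hq0 (5 - 3)
    rwa [← hUq] at this
  · obtain ⟨R, hR⟩ := exists_memLp_pd_radial hpa hp0
    refine ⟨R, fun l i j => ?_⟩
    have hmet' : (fun y => (dataEx m₁ k).metric y i j)
        = fun y => (if i = j then p ‖y‖⁻¹ else 0) + (1 : Mat3) i j := by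
      ext y
      rw [← hmet]; ring
    have hpd : (fun x => pd l (fun y => (dataEx m₁ k).metric y i j) x)
        = pd l fun y => if i = j then p ‖y‖⁻¹ else 0 := by
      ext x
      rw [hmet']
      simp only [pd, fderiv_add_const]
    rw [hpd]
    split_ifs
    · exact hR l
    · have : pd l (fun _ => (0 : ℝ)) = fun _ => 0 := by
        ext x; exact pd_const 0 l x
      rw [this]
      exact MeasureTheory.MemLp.zero'

/-! ### Integration of radial functions -/

lemma volume_real_unitBall : (volume : Measure E3).real (Metric.ball 0 1) = Real.pi * 4 / 3 := by
  rw [measureReal_def, EuclideanSpace.volume_ball_fin_three]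
  simp
  positivity

lemma norm_indicator_exterior (m₁ : ℝ) (f : ℝ → ℝ) :
    (exterior m₁).indicator (fun x => f ‖x‖)
      = fun x => (Set.Ici (m₁ / 2)).indicator f ‖x‖ := by
  ext x
  by_cases h : m₁ / 2 ≤ ‖x‖ <;> simp [exterior, Set.indicator, h]

lemma measurableSet_exterior (m₁ : ℝ) : MeasurableSet (exterior m₁) :=
  measurableSet_le measurable_const measurable_norm

lemma indicator_mul_sq (m₁ : ℝ) (f : ℝ → ℝ) :
    (fun y : ℝ => y ^ (Module.finrank ℝ E3 - 1) • (Set.Ici (m₁ / 2)).indicator f y)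
      = (Set.Ici (m₁ / 2)).indicator fun y => y ^ 2 * f y := by
  ext y
  by_cases h : m₁ / 2 ≤ y <;> simp [Set.indicator, h]

lemma Ici_inter_Ioi_zero {m₁ : ℝ} (hm : 0 < m₁) :
    Set.Ioi (0 : ℝ) ∩ Set.Ici (m₁ / 2) = Set.Ici (m₁ / 2) :=
  Set.inter_eq_right.2 fun y hy => lt_of_lt_of_le (by positivity : (0 : ℝ) < m₁ / 2) hy

lemma integrableOn_exterior_radial {m₁ : ℝ} (hm : 0 < m₁) {f : ℝ → ℝ}
    (h : IntegrableOn (fun r => r ^ 2 * f r) (Set.Ioi (m₁ / 2))) :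
    IntegrableOn (fun x : E3 => f ‖x‖) (exterior m₁) := by
  rw [← integrable_indicator_iff (measurableSet_exterior m₁), norm_indicator_exterior,
    integrable_fun_norm_addHaar, indicator_mul_sq, IntegrableOn,
    integrable_indicator_iff measurableSet_Ici, IntegrableOn,
    Measure.restrict_restrict measurableSet_Ici, Set.inter_comm, Ici_inter_Ioi_zero hm]
  rw [← IntegrableOn, integrableOn_Ici_iff_integrableOn_Ioi]
  exact h

lemma setIntegral_exterior_radial {m₁ : ℝ} (hm : 0 < m₁) (f : ℝ → ℝ) :
    ∫ x in exterior m₁, f ‖x‖ = 4 * Real.pi * ∫ r in Set.Ioi (m₁ / 2), r ^ 2 * f r := by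
  rw [← integral_indicator (measurableSet_exterior m₁), norm_indicator_exterior,
    integral_fun_norm_addHaar, indicator_mul_sq, setIntegral_indicator measurableSet_Ici,
    Ici_inter_Ioi_zero hm, integral_Ici_eq_integral_Ioi, volume_real_unitBall]
  simp
  ring

lemma sphereIntegral_const {R : ℝ} {f : E3 → ℝ} {c : ℝ} (hR : 0 ≤ R)
    (hf : ∀ x : E3, ‖x‖ = R → f x = c) : sphereIntegral R f = 4 * Real.pi * R ^ 2 * c := by
  have h : ∀ p : Metric.sphere (0 : E3) 1, f (R • (p : E3)) = c := fun p =>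
    hf _ (by rw [norm_smul, norm_eq_of_mem_sphere, Real.norm_of_nonneg hR, mul_one])
  simp only [sphereIntegral, h, integral_const, Measure.toSphere_real_apply_univ,
    volume_real_unitBall]
  simp
  ring

/-! ### The radial volume integrand -/

lemma gradient_radial {φ : ℝ → ℝ} {φ' : ℝ} {x : E3} (hx : x ≠ 0) (h : HasDerivAt φ φ' ‖x‖) :
    gradient (fun y : E3 => φ ‖y‖) x = (φ' * ‖x‖⁻¹) • x := by
  refine HasGradientAt.gradient (hasGradientAt_iff_hasFDerivAt.2 ?_)
  refine (h.comp_hasFDerivAt x (hasFDerivAt_norm hx)).congr_fderiv ?_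
  ext v
  simp
  ring

/-- The radial derivative `U'` of `UEx`. -/
noncomputable def dU (m₁ k r : ℝ) : ℝ :=
  -2 * ((-(6 * k + m₁ ^ 2) / (2 * m₁ * r ^ 2) + k / r ^ 3) / profile m₁ k r)

/-- The radial derivative of `Φ_* - Ψ_*`. -/
noncomputable def dχ (m₁ r : ℝ) : ℝ := m₁ ^ 2 / (2 * r ^ 3) - m₁ / r ^ 2

lemma hasDerivAt_PhiStar {m₁ r : ℝ} (hr : 0 < r) :
    HasDerivAt (fun r => 1 - m₁ ^ 2 / (4 * r ^ 2)) (m₁ ^ 2 / (2 * r ^ 3)) r := by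
  have h := ((((hasDerivAt_pow 2 r).const_mul 4).inv (by positivity)).const_mul
    (m₁ ^ 2)).const_sub 1
  refine h.congr_deriv ?_
  simp
  field_simp
  ring

lemma hasDerivAt_PsiStar {m₁ r : ℝ} (hr : 0 < r) :
    HasDerivAt (fun r => -(m₁ / r)) (m₁ / r ^ 2) r := by
  have h := ((hasDerivAt_inv hr.ne').const_mul m₁).neg
  refine h.congr_deriv ?_
  field_simp

/-- The volume integrand of `J` as a function of `r`. At `r = m₁/2`, where `Φ_*` vanishes, its value
is without meaning; this is a null set. -/
noncomputable def radialIntegrand (m₁ k r : ℝ) : ℝ :=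
  1 / 2 * (1 - m₁ ^ 2 / (4 * r ^ 2)) * (dU m₁ k r + 1 / (1 - m₁ ^ 2 / (4 * r ^ 2)) * dχ m₁ r) ^ 2
    - 1 / (2 * (1 - m₁ ^ 2 / (4 * r ^ 2))) * dχ m₁ r ^ 2

lemma volumeIntegrand_eq {m₁ k : ℝ} (hm : 0 < m₁) (hk : 0 < k) {x : E3} (hx : x ∈ exterior m₁) :
    volumeIntegrand (PhiStar m₁) (PsiStar m₁) (UEx m₁ k) x = radialIntegrand m₁ k ‖x‖ := by
  have hx4 := quarter_lt_norm hm hx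
  have hx0 : x ≠ 0 := ne_zero_of_lt_norm (by positivity) hx4
  have hr : 0 < ‖x‖ := norm_pos_iff.2 hx0
  have h1 : gradient (UEx m₁ k) x = (dU m₁ k ‖x‖ * ‖x‖⁻¹) • x :=
    gradient_radial hx0 (hasDerivAt_log_profile hm hk hx4)
  have h2 : gradient (fun y => PhiStar m₁ y - PsiStar m₁ y) x = (dχ m₁ ‖x‖ * ‖x‖⁻¹) • x :=
    gradient_radial hx0 ((hasDerivAt_PhiStar hr).sub (hasDerivAt_PsiStar hr))
  have hn : ∀ a : ℝ, ‖(a * ‖x‖⁻¹) • x‖ ^ 2 = a ^ 2 := by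
    intro a
    rw [norm_smul, mul_pow, Real.norm_eq_abs, sq_abs]
    field_simp
  have h3 : (dU m₁ k ‖x‖ * ‖x‖⁻¹) • x + (1 / PhiStar m₁ x) • (dχ m₁ ‖x‖ * ‖x‖⁻¹) • x =
      ((dU m₁ k ‖x‖ + 1 / PhiStar m₁ x * dχ m₁ ‖x‖) * ‖x‖⁻¹) • x := by
    module
  rw [volumeIntegrand, h1, h2, h3, hn, hn]
  rfl

/-- The leading part of the radial volume density (with its sign reversed), namely the density of
the data with `k = 0`. -/
noncomputable def zerothDensity (m₁ r : ℝ) : ℝ := m₁ ^ 2 * (2 * r - m₁) / (2 * r ^ 2 * (2 * r + m₁))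

/-- An upper bound for the remaining part of the radial volume density; it is exact to second
order in `k`. -/
noncomputable def secondDensity (m₁ k r : ℝ) : ℝ :=
  k ^ 2 / (2 * m₁ ^ 2) * ((2 * r - m₁) ^ 3 * (6 * r + m₁) ^ 2 / (r ^ 4 * (2 * r + m₁) ^ 3))

/-- The logarithmic derivative of `u` deviates from that of `1 + m₁/(2r)` by at most its first
variation in `k`, since `u` is at least `1 + m₁/(2r)`. -/
lemma abs_dU_sub_le {m₁ k r : ℝ} (hm : 0 < m₁) (hk : 0 < k) (hr : m₁ / 2 < r) :
    |dU m₁ k r - 2 * m₁ / (r * (2 * r + m₁))| ≤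
      2 * k * (2 * r - m₁) * (6 * r + m₁) / (m₁ * r ^ 2 * (2 * r + m₁) ^ 2) := by
  have hr0 : 0 < r := by linarith
  have hd : 0 < 2 * r - m₁ := by linarith
  have hu := one_lt_profile hm hk (show m₁ / 4 < r by linarith)
  have hu0 : 0 < profile m₁ k r := by linarith
  have hle : (2 * r + m₁) / (2 * r) ≤ profile m₁ k r := by
    have : profile m₁ k r - (2 * r + m₁) / (2 * r) = k * (6 * r - m₁) / (2 * m₁ * r ^ 2) := by
      rw [profile]; field_simp; ring
    have h2 : 0 ≤ k * (6 * r - m₁) / (2 * m₁ * r ^ 2) := by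
      have : 0 < 6 * r - m₁ := by linarith
      positivity
    linarith
  have heq : dU m₁ k r - 2 * m₁ / (r * (2 * r + m₁)) =
      k * (2 * r - m₁) * (6 * r + m₁) / (m₁ * r ^ 3 * (2 * r + m₁)) / profile m₁ k r := by
    rw [dU, eq_div_iff hu0.ne', sub_mul, mul_assoc, div_mul_cancel₀ _ hu0.ne', profile]
    field_simp
    ring
  have hnn : 0 ≤ k * (2 * r - m₁) * (6 * r + m₁) / (m₁ * r ^ 3 * (2 * r + m₁)) := by positivity
  rw [heq, abs_of_nonneg (by positivity)]
  calc _ ≤ k * (2 * r - m₁) * (6 * r + m₁) / (m₁ * r ^ 3 * (2 * r + m₁))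
        / ((2 * r + m₁) / (2 * r)) := by gcongr
    _ = _ := by field_simp

/-- The radial density minus its value at `k = 0`; the terms linear in the variation of `U` cancel
because the data with `k = 0` is a critical point. -/
lemma radialIntegrand_add_zerothDensity {m₁ k r : ℝ} (hm : 0 < m₁) (hr : m₁ / 2 < r) :
    r ^ 2 * radialIntegrand m₁ k r + zerothDensity m₁ r =
      (2 * r - m₁) * (2 * r + m₁) / 8 * (dU m₁ k r - 2 * m₁ / (r * (2 * r + m₁))) ^ 2 := by
  have hr0 : 0 < r := by linarith
  have hd : 0 < 2 * r - m₁ := by linarith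
  have hΦ : 1 - m₁ ^ 2 / (4 * r ^ 2) = (2 * r - m₁) * (2 * r + m₁) / (4 * r ^ 2) := by
    field_simp; ring
  have hsq : ∀ Φ y z : ℝ, Φ ≠ 0 →
      1 / 2 * Φ * (y + 1 / Φ * z) ^ 2 - 1 / (2 * Φ) * z ^ 2 = 1 / 2 * Φ * y ^ 2 + y * z := by
    intro Φ y z h
    field_simp
    ring
  rw [radialIntegrand, hsq _ _ _ (by rw [hΦ]; positivity), hΦ, zerothDensity, dχ]
  generalize dU m₁ k r = y
  field_simp
  ring

lemma remainder_le_secondDensity {m₁ k r : ℝ} (hm : 0 < m₁) (hk : 0 < k) (hr : m₁ / 2 < r) :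
    |r ^ 2 * radialIntegrand m₁ k r + zerothDensity m₁ r| ≤ secondDensity m₁ k r := by
  have hr0 : 0 < r := by linarith
  have hd : 0 < 2 * r - m₁ := by linarith
  rw [radialIntegrand_add_zerothDensity hm hr, abs_mul, abs_pow, abs_of_pos (by positivity)]
  calc _ ≤ (2 * r - m₁) * (2 * r + m₁) / 8 *
        (2 * k * (2 * r - m₁) * (6 * r + m₁) / (m₁ * r ^ 2 * (2 * r + m₁) ^ 2)) ^ 2 := by
        gcongr
        exact abs_dU_sub_le hm hk hr
    _ = _ := by rw [secondDensity]; field_simp; ring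

lemma tendsto_two_add_div (m₁ : ℝ) : Tendsto (fun r : ℝ => 2 + m₁ / r) atTop (𝓝 2) := by
  simpa using (tendsto_const_nhds (x := m₁)).div_atTop tendsto_id |>.const_add (2 : ℝ)

lemma hasDerivAt_two_add_div (m₁ : ℝ) {r : ℝ} (hr : 0 < r) :
    HasDerivAt (fun r : ℝ => 2 + m₁ / r) (-(m₁ / r ^ 2)) r := by
  have h := ((hasDerivAt_inv hr.ne').const_mul m₁).const_add 2
  refine h.congr_deriv ?_
  field_simp

/-- `∫ (k = 0 density) = 2 m₁ log 2 - m₁`, in the variable `t = 2 + m₁/r`. -/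
lemma integral_zerothDensity {m₁ : ℝ} (hm : 0 < m₁) :
    IntegrableOn (zerothDensity m₁) (Set.Ioi (m₁ / 2)) ∧
      ∫ r in Set.Ioi (m₁ / 2), zerothDensity m₁ r = 2 * m₁ * Real.log 2 - m₁ := by
  set A : ℝ → ℝ := fun t => m₁ / 2 * t - 2 * m₁ * Real.log t with hA
  have hAd : ∀ t, 0 < t → HasDerivAt A (m₁ / 2 - 2 * m₁ * t⁻¹) t := fun t ht =>
    (((hasDerivAt_id t).const_mul (m₁ / 2)).sub ((Real.hasDerivAt_log ht.ne').const_mul (2 * m₁))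
      ).congr_deriv (by simp)
  have hd : ∀ r, 0 < r → HasDerivAt (fun r => A (2 + m₁ / r)) (zerothDensity m₁ r) r := by
    intro r hr
    refine ((hAd (2 + m₁ / r) (by positivity)).comp r (hasDerivAt_two_add_div m₁ hr)).congr_deriv ?_
    rw [zerothDensity]
    field_simp
    ring
  have hc : ContinuousWithinAt (fun r => A (2 + m₁ / r)) (Set.Ici (m₁ / 2)) (m₁ / 2) :=
    (hd _ (by positivity)).continuousAt.continuousWithinAt
  have hd' : ∀ r ∈ Set.Ioi (m₁ / 2), HasDerivAt (fun r => A (2 + m₁ / r)) (zerothDensity m₁ r) r :=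
    fun r hr => hd r (lt_trans (by positivity : (0 : ℝ) < m₁ / 2) hr)
  have hnn : ∀ r ∈ Set.Ioi (m₁ / 2), 0 ≤ zerothDensity m₁ r := by
    intro r hr
    have hr : m₁ / 2 < r := hr
    have : 0 < r := by linarith
    have : 0 < 2 * r - m₁ := by linarith
    rw [zerothDensity]
    positivity
  have hlim : Tendsto (fun r => A (2 + m₁ / r)) atTop (𝓝 (A 2)) :=
    (hAd 2 two_pos).continuousAt.tendsto.comp (tendsto_two_add_div m₁)
  refine ⟨integrableOn_Ioi_deriv_of_nonneg hc hd' hnn hlim, ?_⟩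
  rw [integral_Ioi_of_hasDerivAt_of_nonneg hc hd' hnn hlim]
  have h4 : 2 + m₁ / (m₁ / 2) = 4 := by field_simp; norm_num
  have hlog : Real.log 4 = 2 * Real.log 2 := by
    rw [show (4 : ℝ) = 2 ^ 2 by norm_num, Real.log_pow]; norm_num
  simp only [hA, h4, hlog]
  ring

lemma integral_secondDensity {m₁ : ℝ} (hm : 0 < m₁) (k : ℝ) :
    IntegrableOn (secondDensity m₁ k) (Set.Ioi (m₁ / 2)) ∧
      ∫ r in Set.Ioi (m₁ / 2), secondDensity m₁ k r =
        k ^ 2 / (2 * m₁ ^ 3) * (304 / 3 - 128 * Real.log 2) := by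
  -- the integrand is `(16 - t²)² (4 - t) / t³` up to a constant factor
  set A : ℝ → ℝ := fun t => -(k ^ 2 / (2 * m₁ ^ 3)) *
    (-512 * (t ^ 2)⁻¹ + 256 * t⁻¹ - 128 * Real.log t + 32 * t + 2 * t ^ 2 - t ^ 3 / 3) with hA
  have hAd : ∀ t, 0 < t → HasDerivAt A
      (-(k ^ 2 / (2 * m₁ ^ 3)) * ((16 - t ^ 2) ^ 2 * (4 - t) / t ^ 3)) t := by
    intro t ht
    have h1 := ((hasDerivAt_pow 2 t).inv (by positivity)).const_mul (-512)
    have h2 := (hasDerivAt_inv ht.ne').const_mul 256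
    have h3 := (Real.hasDerivAt_log ht.ne').const_mul 128
    have h4 := (hasDerivAt_id t).const_mul 32
    have h5 := (hasDerivAt_pow 2 t).const_mul 2
    have h6 := (hasDerivAt_pow 3 t).div_const 3
    refine ((((((h1.add h2).sub h3).add h4).add h5).sub h6).const_mul _).congr_deriv ?_
    simp
    left
    field_simp
    ring
  have hd : ∀ r, 0 < r → HasDerivAt (fun r => A (2 + m₁ / r)) (secondDensity m₁ k r) r := by
    intro r hr
    refine ((hAd (2 + m₁ / r) (by positivity)).comp r (hasDerivAt_two_add_div m₁ hr)).congr_deriv ?_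
    rw [secondDensity]
    field_simp
    ring
  have hc : ContinuousWithinAt (fun r => A (2 + m₁ / r)) (Set.Ici (m₁ / 2)) (m₁ / 2) :=
    (hd _ (by positivity)).continuousAt.continuousWithinAt
  have hd' : ∀ r ∈ Set.Ioi (m₁ / 2),
      HasDerivAt (fun r => A (2 + m₁ / r)) (secondDensity m₁ k r) r :=
    fun r hr => hd r (lt_trans (by positivity : (0 : ℝ) < m₁ / 2) hr)
  have hnn : ∀ r ∈ Set.Ioi (m₁ / 2), 0 ≤ secondDensity m₁ k r := by
    intro r hr
    have hr : m₁ / 2 < r := hr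
    have : 0 < r := by linarith
    have : 0 < 2 * r - m₁ := by linarith
    rw [secondDensity]
    positivity
  have hlim : Tendsto (fun r => A (2 + m₁ / r)) atTop (𝓝 (A 2)) :=
    (hAd 2 two_pos).continuousAt.tendsto.comp (tendsto_two_add_div m₁)
  refine ⟨integrableOn_Ioi_deriv_of_nonneg hc hd' hnn hlim, ?_⟩
  rw [integral_Ioi_of_hasDerivAt_of_nonneg hc hd' hnn hlim]
  have h4 : 2 + m₁ / (m₁ / 2) = 4 := by field_simp; norm_num
  have hlog : Real.log 4 = 2 * Real.log 2 := by
    rw [show (4 : ℝ) = 2 ^ 2 by norm_num, Real.log_pow]; norm_num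
  simp only [hA, h4, hlog]
  ring

lemma integral_radialIntegrand_le {m₁ k : ℝ} (hm : 0 < m₁) (hk : 0 < k) :
    IntegrableOn (fun r => r ^ 2 * radialIntegrand m₁ k r) (Set.Ioi (m₁ / 2)) ∧
      ∫ r in Set.Ioi (m₁ / 2), r ^ 2 * radialIntegrand m₁ k r ≤
        m₁ - 2 * m₁ * Real.log 2 + k ^ 2 / (2 * m₁ ^ 3) * (304 / 3 - 128 * Real.log 2) := by
  obtain ⟨hi0, hI0⟩ := integral_zerothDensity hm
  obtain ⟨hi2, hI2⟩ := integral_secondDensity hm k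
  have hmeas : Measurable fun r => r ^ 2 * radialIntegrand m₁ k r + zerothDensity m₁ r := by
    unfold radialIntegrand zerothDensity dU dχ profile
    fun_prop
  have hrem : IntegrableOn (fun r => r ^ 2 * radialIntegrand m₁ k r + zerothDensity m₁ r)
      (Set.Ioi (m₁ / 2)) :=
    hi2.mono' hmeas.aestronglyMeasurable ((ae_restrict_iff' measurableSet_Ioi).2
      (Eventually.of_forall fun r hr => remainder_le_secondDensity hm hk hr))
  have heq : (fun r => r ^ 2 * radialIntegrand m₁ k r) =
      fun r => (r ^ 2 * radialIntegrand m₁ k r + zerothDensity m₁ r) - zerothDensity m₁ r := by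
    ext r; ring
  rw [heq]
  refine ⟨hrem.sub hi0, ?_⟩
  rw [integral_sub hrem hi0, hI0]
  have := setIntegral_mono_on hrem hi2 measurableSet_Ioi fun r hr =>
    (le_abs_self _).trans (remainder_le_secondDensity hm hk hr)
  rw [hI2] at this
  linarith

/-! ### The sign of `J` -/

lemma profile_horizon {m₁ k : ℝ} (hm : 0 < m₁) :
    profile m₁ k (m₁ / 2) = 2 * (1 + 2 * k / m₁ ^ 2) := by
  rw [profile]; field_simp; ring

lemma UEx_horizon {m₁ k : ℝ} (hm : 0 < m₁) {x : E3} (hx : ‖x‖ = m₁ / 2) :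
    UEx m₁ k x = -2 * Real.log (2 * (1 + 2 * k / m₁ ^ 2)) := by
  rw [UEx_eq]
  simp only [hx, profile_horizon hm]

lemma boundaryIntegrand_horizon {m₁ k : ℝ} (hm : 0 < m₁) {x : E3} (hx : ‖x‖ = m₁ / 2) :
    boundaryIntegrand m₁ (PhiStar m₁) (PsiStar m₁) (UEx m₁ k) (fun _ => 0) x =
      8 / m₁ * Real.log (2 * (1 + 2 * k / m₁ ^ 2)) := by
  have hx0 : x ≠ 0 := by rw [← norm_pos_iff, hx]; positivity
  have hr : 0 < ‖x‖ := norm_pos_iff.2 hx0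
  have hΨ : radialDeriv (PsiStar m₁) x = m₁ / ‖x‖ ^ 2 := by
    have h : HasFDerivAt (PsiStar m₁) ((m₁ / ‖x‖ ^ 2) • ‖x‖⁻¹ • innerSL ℝ x) x :=
      (hasDerivAt_PsiStar hr).comp_hasFDerivAt x (hasFDerivAt_norm hx0)
    rw [radialDeriv, h.fderiv]
    simp
    field_simp
  rw [boundaryIntegrand, hΨ, UEx_horizon hm hx, PhiStar, hx]
  field_simp
  ring

lemma log_one_add_le {x : ℝ} (hx : 0 < x) (hx' : x < 1 / 10) :
    Real.log (1 + x) ≤ x - x ^ 2 / 2 + x ^ 2 / 9 := by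
  have h := Real.abs_log_sub_add_sum_range_le (x := -x) (by rw [abs_neg, abs_of_pos hx]; linarith) 2
  simp only [Finset.sum_range_succ, Finset.sum_range_zero, abs_neg, abs_of_pos hx] at h
  have h1 := (abs_le.1 h).2
  have h2 : x ^ (2 + 1) / (1 - x) ≤ x ^ 2 / 9 := by
    rw [div_le_div_iff₀ (by linarith) (by norm_num), pow_succ x 2]
    nlinarith [mul_nonneg (sq_nonneg x) (show (0 : ℝ) ≤ 1 - 10 * x by linarith)]
  norm_num at h1 h2
  linarith

lemma J_dataEx_neg {m₁ k : ℝ} (hm : 0 < m₁) (hk : 0 < k) (hk' : k < m₁ ^ 2 / 20) :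
    J m₁ (PhiStar m₁) (PsiStar m₁) (UEx m₁ k) (fun _ => 0) < 0 := by
  set x : ℝ := 2 * k / m₁ ^ 2 with hx
  have hx0 : 0 < x := by positivity
  have hx1 : x < 1 / 10 := by
    rw [hx, div_lt_iff₀ (by positivity)]; linarith
  have hkx : k = m₁ ^ 2 * x / 2 := by rw [hx]; field_simp
  have hπ := Real.pi_pos
  have hvol : 1 / (4 * Real.pi) * ∫ y in exterior m₁,
      volumeIntegrand (PhiStar m₁) (PsiStar m₁) (UEx m₁ k) y =
      ∫ r in Set.Ioi (m₁ / 2), r ^ 2 * radialIntegrand m₁ k r := by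
    rw [setIntegral_congr_fun (measurableSet_exterior m₁) fun y hy => volumeIntegrand_eq hm hk hy,
      setIntegral_exterior_radial hm]
    field_simp
  have hbd : 1 / (4 * Real.pi) * sphereIntegral (m₁ / 2)
      (boundaryIntegrand m₁ (PhiStar m₁) (PsiStar m₁) (UEx m₁ k) fun _ => 0) =
      2 * m₁ * (Real.log 2 + Real.log (1 + x)) := by
    rw [sphereIntegral_const (by positivity) fun y hy => boundaryIntegrand_horizon hm hy,
      ← hx, Real.log_mul two_ne_zero (by positivity)]
    field_simp
    ring
  have harea : Real.sqrt (1 / (16 * Real.pi) * sphereIntegral (m₁ / 2)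
      (fun y => Real.exp ((fun _ => (0 : ℝ)) y - 2 * UEx m₁ k y))) = m₁ * (1 + x) ^ 2 := by
    have hexp : ∀ y : E3, ‖y‖ = m₁ / 2 → Real.exp ((fun _ => (0 : ℝ)) y - 2 * UEx m₁ k y) =
        (2 * (1 + x)) ^ 4 := by
      intro y hy
      rw [UEx_horizon hm hy, show (0 : ℝ) - 2 * (-2 * Real.log (2 * (1 + 2 * k / m₁ ^ 2)))
        = Real.log ((2 * (1 + x)) ^ 4) by rw [Real.log_pow]; push_cast; ring]
      exact Real.exp_log (by positivity)
    rw [sphereIntegral_const (by positivity) hexp,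
      ← Real.sqrt_sq (by positivity : 0 ≤ m₁ * (1 + x) ^ 2)]
    congr 1
    field_simp
    ring
  rw [J, hvol, hbd, harea]
  have hI := (integral_radialIntegrand_le hm hk).2
  have hlog := log_one_add_le hx0 hx1
  have hlog2 : 0.6931 < Real.log 2 := by linarith [Real.log_two_gt_d9]
  -- `(304/3 - 128 * 0.6931) / 8 < 8/5`
  have hsec : k ^ 2 / (2 * m₁ ^ 3) * (304 / 3 - 128 * Real.log 2) ≤ m₁ * x ^ 2 * (8 / 5) := by
    have : k ^ 2 / (2 * m₁ ^ 3) = m₁ * x ^ 2 / 8 := by rw [hkx]; field_simp; ring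
    rw [this]
    have : 0 < m₁ * x ^ 2 := by positivity
    nlinarith
  have h1 := mul_le_mul_of_nonneg_left hlog (show (0 : ℝ) ≤ 2 * m₁ by positivity)
  have h2 : 0 < m₁ * x ^ 2 := by positivity
  nlinarith

end AxiPenrose

theorem mainTheorem9 (m₁ : ℝ) (hm₁ : 0 < m₁) :
    ∃ k₀ : ℝ, 0 < k₀ ∧ ∀ k : ℝ, 0 < k → k < k₀ →
      AxiPenrose.Admissible m₁ (AxiPenrose.dataEx m₁ k) ∧
      (∀ x ∈ AxiPenrose.exterior m₁,
        0 < AxiPenrose.scalarCurvature (AxiPenrose.dataEx m₁ k).metric x) ∧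
      (∃ C_H : ℝ, C_H < -2 * Real.log 2 ∧ ∀ x ∈ AxiPenrose.horizon m₁,
        (AxiPenrose.dataEx m₁ k).U x - (1 / 2) * (AxiPenrose.dataEx m₁ k).α x = C_H) ∧
      MeasureTheory.IntegrableOn
        (AxiPenrose.volumeIntegrand (AxiPenrose.PhiStar m₁) (AxiPenrose.PsiStar m₁)
          (AxiPenrose.dataEx m₁ k).U)
        (AxiPenrose.exterior m₁) ∧
      AxiPenrose.J m₁ (AxiPenrose.PhiStar m₁) (AxiPenrose.PsiStar m₁)
        (AxiPenrose.dataEx m₁ k).U (AxiPenrose.dataEx m₁ k).α < 0 := by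
  -- `k < m₁²/6` is needed for `∂M` to be outermost; the smaller bound makes `2k/m₁² < 1/10`, so that
  -- the cubic term of the logarithm is negligible in `J`
  refine ⟨m₁ ^ 2 / 20, by positivity, fun k hk hk' => ?_⟩
  have hk6 : k < m₁ ^ 2 / 6 := by
    have : 0 < m₁ ^ 2 := by positivity
    linarith
  refine ⟨AxiPenrose.admissible_dataEx hm₁ hk hk6,
    fun x hx => AxiPenrose.scalarCurvature_dataEx hm₁ hk hx,
    ⟨-2 * Real.log (2 * (1 + 2 * k / m₁ ^ 2)), ?_, fun x hx => ?_⟩, ?_,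
    AxiPenrose.J_dataEx_neg hm₁ hk hk'⟩
  · have hx : 0 < 2 * k / m₁ ^ 2 := by positivity
    have := Real.log_lt_log two_pos (show (2 : ℝ) < 2 * (1 + 2 * k / m₁ ^ 2) by linarith)
    linarith
  · have hn : ‖x‖ = m₁ / 2 := by simpa [AxiPenrose.horizon] using hx
    simp only [AxiPenrose.dataEx, AxiPenrose.UEx_horizon hm₁ hn]
    ring
  · exact (AxiPenrose.integrableOn_exterior_radial hm₁
      (AxiPenrose.integral_radialIntegrand_le hm₁ hk).1).congr_fun
      (fun x hx => (AxiPenrose.volumeIntegrand_eq hm₁ hk hx).symm)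
      (AxiPenrose.measurableSet_exterior m₁)
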